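/- **Setting.** Let $H$ be a (possibly unbounded) self-adjoint operator on a complex Hilbert space $\mathcal B$, with spectrum $\sigma(H)\subseteq\mathbb R$. Write $\langle x\rangle=(1+x^2)^{1/2}$. For $\beta\in\mathbb R$ let $S^\beta$ be the set of smooth $f:\mathbb R\to\mathbb C$ such that for every $n\ge 0$ there is $c_n>0$ with $|f^{(n)}(x)|\le c_n\langle x\rangle^{\beta-n}$ for all $x$, and let $\mathcal A=\bigcup_{\beta<0}S^\beta$. Then $\mathcal A\subseteq C_0(\mathbb R)$, the space of continuous functions $\mathbb R\to\mathbb C$ vanishing at infinity, with the sup-norm. Fix an integer $n\ge 1$ and a smooth function $\tau:\mathbb R^2\to\mathbb R$ with $\tau(x,y)=1$ for $|y|\le\langle x\rangle$, $\tau(x,y)=0$ for $|y|\ge 2\langle x\rangle$, and $|\partial_x\tau|,|\partial_y\tau|\le c\,\langle x\rangle^{-1}$ for some constant $c$ (for example $\tau(x,y)=\omega(y/\langle x\rangle)$ with $\omega$ smooth, $\omega=1$ on $[-1,1]$, $\omega=0$ off $(-2,2)$). For $f\in\mathcal A$ put $$\tilde f(x,y)=\Bigl(\sum_{r=0}^n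 f^{(r)}(x)\frac{(iy)^r}{r!}\Bigr)\tau(x,y),\qquad \frac{\partial\tilde f}{\partial\bar z}=\frac12\Bigl(\frac{\partial\tilde f}{\partial x}+i\frac{\partial\tilde f}{\partial y}\Bigr),$$ $$f(H)=-\frac1\pi\iint_{\mathbb C}\frac{\partial\tilde f}{\partial\bar z}\,(z-H)^{-1}\,dx\,dy ,\qquad z=x+iy.$$ For $f\in C_0(\mathbb R)$ let $f(H)=\lim g(H)$, the operator-norm limit as $g\in\mathcal A$ tends to $f$ uniformly on $\mathbb R$. **Statement.** This is well defined: the integral converges absolutely in operator norm for every $f\in\mathcal A$, the algebra $\mathcal A$ is dense in $C_0(\mathbb R)$, and the limit exists for every $f\in C_0(\mathbb R)$. Moreover, for every $f\in C_0(\mathbb R)$, $$\overline{f(\sigma(H))}\subseteq\sigma(f(H)).$$ -/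

import Mathlib

open scoped ContDiff ZeroAtInfty Topology
open MeasureTheory Filter

noncomputable section

namespace HelfferSjostrand

/-- The bracket `⟨x⟩ = (1 + x ^ 2) ^ (1 / 2)`. -/
def bracket (x : ℝ) : ℝ := Real.sqrt (1 + x ^ 2)

/-- The class `S^β`: smooth functions `f : ℝ → ℂ` such that, for every `n`, the `n`-th derivative
is bounded by a constant times `⟨x⟩ ^ (β - n)`. -/
def SymbolClass (β : ℝ) : Set (ℝ → ℂ) :=
  {f | ContDiff ℝ ∞ f ∧
    ∀ n : ℕ, ∃ c : ℝ, 0 < c ∧ ∀ x : ℝ, ‖iteratedDeriv n f x‖ ≤ c * bracket x ^ (β - n)}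

/-- The algebra `𝒜`, the union of the classes `S^β` over `β < 0`. -/
def SlowDecay : Set (ℝ → ℂ) := ⋃ β : ℝ, ⋃ _ : β < 0, SymbolClass β

/-- The elements of `C₀(ℝ)` that belong to the algebra `𝒜`. Every element of `𝒜` is continuous and
vanishes at infinity, so this is `𝒜`, carrying the topology of uniform convergence. -/
def SlowDecayC0 : Set C₀(ℝ, ℂ) := {f | (f : ℝ → ℂ) ∈ SlowDecay}

/-- Cut-off functions used for almost analytic extensions: smooth functions on the plane, equal to
`1` for `|y| ≤ ⟨x⟩`, equal to `0` for `|y| ≥ 2⟨x⟩`, with first partial derivatives of size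
`O(1 / ⟨x⟩)`. The functions `τ(x, y) = ω(y / ⟨x⟩)`, with `ω` smooth, `ω = 1` on `[-1, 1]` and
`ω = 0` off `(-2, 2)`, are of this kind. -/
structure IsCutoff (τ : ℝ → ℝ → ℝ) : Prop where
  smooth : ContDiff ℝ ∞ (fun p : ℝ × ℝ => τ p.1 p.2)
  eq_one : ∀ x y : ℝ, |y| ≤ bracket x → τ x y = 1
  eq_zero : ∀ x y : ℝ, 2 * bracket x ≤ |y| → τ x y = 0
  deriv_bound : ∃ c : ℝ, ∀ x y : ℝ,
    |deriv (fun s : ℝ => τ s y) x| ≤ c / bracket x ∧ |deriv (fun t : ℝ => τ x t) y| ≤ c / bracket x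

/-- The almost analytic extension of order `n` of `f`,
`(∑ r ≤ n, f⁽ʳ⁾(x) (i y) ^ r / r!) τ(x, y)`. -/
def almostAnalytic (τ : ℝ → ℝ → ℝ) (n : ℕ) (f : ℝ → ℂ) (x y : ℝ) : ℂ :=
  (∑ r ∈ Finset.range (n + 1),
    iteratedDeriv r f x * (Complex.I * (y : ℂ)) ^ r / (r.factorial : ℂ)) * (τ x y : ℂ)

/-- The operator `∂/∂z̄ = (∂/∂x + i ∂/∂y) / 2` on functions of two real variables. -/
def dbar (F : ℝ → ℝ → ℂ) (x y : ℝ) : ℂ :=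
  (1 / 2 : ℂ) * (deriv (fun s : ℝ => F s y) x + Complex.I * deriv (fun t : ℝ => F x t) y)

variable {E : Type*} [NormedAddCommGroup E] [InnerProductSpace ℂ E]

/-- `R` is the bounded two-sided inverse of `z - H`. -/
def IsResolventAt (H : E →ₗ.[ℂ] E) (z : ℂ) (R : E →L[ℂ] E) : Prop :=
  (∀ v : E, ∃ h : R v ∈ H.domain, z • R v - H ⟨R v, h⟩ = v) ∧
    ∀ u : H.domain, R (z • (u : E) - H u) = u

/-- The spectrum of a (possibly unbounded) operator: the set of those `z` for which `z - H` does
not have a bounded two-sided inverse. -/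
def opSpectrum (H : E →ₗ.[ℂ] E) : Set ℂ := {z | ¬ ∃ R : E →L[ℂ] E, IsResolventAt H z R}

open Classical in
/-- The resolvent operator `(z - H)⁻¹`; it is given the value `0` when `z` is in the spectrum. -/
def resolventOp (H : E →ₗ.[ℂ] E) (z : ℂ) : E →L[ℂ] E :=
  if h : ∃ R : E →L[ℂ] E, IsResolventAt H z R then h.choose else 0

/-- The integrand `(∂f̃/∂z̄)(x, y) (z - H)⁻¹`, with `z = x + i y`, of the Helffer–Sjöstrand
formula. -/
def hsIntegrand (H : E →ₗ.[ℂ] E) (τ : ℝ → ℝ → ℝ) (n : ℕ) (f : ℝ → ℂ) (p : ℝ × ℝ) : E →L[ℂ] E :=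
  dbar (almostAnalytic τ n f) p.1 p.2 • resolventOp H ((p.1 : ℂ) + (p.2 : ℂ) * Complex.I)

/-- The Helffer–Sjöstrand functional calculus on `𝒜`:
`f(H) = -(1/π) ∬ (∂f̃/∂z̄) (z - H)⁻¹ dx dy`. -/
def hsCalculus (H : E →ₗ.[ℂ] E) (τ : ℝ → ℝ → ℝ) (n : ℕ) (f : ℝ → ℂ) : E →L[ℂ] E :=
  (-(1 / (Real.pi : ℂ))) • ∫ p : ℝ × ℝ, hsIntegrand H τ n f p

/-- The extension of the functional calculus from `𝒜` to `C₀(ℝ)`: `f(H)` is the operator-norm limit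
of `g(H)` as `g ∈ 𝒜` tends to `f` uniformly. -/
def c0Calculus (H : E →ₗ.[ℂ] E) (τ : ℝ → ℝ → ℝ) (n : ℕ) (f : C₀(ℝ, ℂ)) : E →L[ℂ] E :=
  limUnder (𝓝[SlowDecayC0] f) (fun g : C₀(ℝ, ℂ) => hsCalculus H τ n g)

end HelfferSjostrand

end

/-!
The proof identifies the Helffer–Sjöstrand calculus with a functional calculus for which spectral
mapping is already known. For nonreal `z` the resolvent `R_z = (z - H)⁻¹` exists
(`exists_isResolventAt`), and `R = R_i` is a bounded normal operator whose spectrum lies on the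
circle `{(i - s)⁻¹ | s ∈ ℝ} ∪ {0}`, because `i - w⁻¹` would otherwise be a nonreal spectral value
of `H`. Hence `f ↦ (w ↦ f (i - w⁻¹))` maps `C₀(ℝ)` to the continuous functions on the spectrum of
`R`, and composing it with the continuous functional calculus of `R` gives a bounded linear map
`Φ = resolventCalculus hH` from `C₀(ℝ)` to the bounded operators. By the resolvent identity, `Φ`
sends the Cauchy kernel `k_z(s) = (z - s)⁻¹` to `R_z` (`resolventCalculus_cauchyKernel`).

For `f ∈ 𝒜` the identity `f = -(1/π) ∬ (∂f̃/∂z̄) k_z dx dy` holds as a Bochner integral in `C₀(ℝ)`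
(`integral_dbar_smul_cauchyKernel`). Absolute convergence comes from
`|∂f̃/∂z̄| ≤ C |y| ⟨x⟩ ^ (β - 2)` on `|y| ≤ 2⟨x⟩` together with `‖k_z‖ ≤ 1 / |y|`; the value at a
real point `s` is the Cauchy–Pompeiu formula, obtained from Green's formula on large squares
centred at `s`. Green's formula can be applied to the difference quotient
`(f̃(z) - f̃(s)) / (z - s)`, which is continuous at `s` because `∂f̃/∂z̄` vanishes on the real axis.
Applying `Φ` under the integral sign gives `f(H) = Φ f` for `f ∈ 𝒜`, independently of the cut-off
and of the order of the extension.

Since `𝒜` contains the smooth functions with compact support, it is dense in `C₀(ℝ)`, and the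
continuity of `Φ` yields the existence of the limit and `f(H) = Φ f` for all `f ∈ C₀(ℝ)`. The
spectrum of `Φ f` is the set of values of `w ↦ f (i - w⁻¹)` on the spectrum of `R`; it contains
`f(s)` for `s ∈ σ(H)`, because then `(i - s)⁻¹` is in the spectrum of `R`, and it is closed.
-/

noncomputable section

namespace HelfferSjostrand

/-! ### Resolvents of a self-adjoint operator -/

section Resolvent

variable {E : Type*} [NormedAddCommGroup E] [InnerProductSpace ℂ E]

theorem IsResolventAt.unique {H : E →ₗ.[ℂ] E} {z : ℂ} {R S : E →L[ℂ] E}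
    (hR : IsResolventAt H z R) (hS : IsResolventAt H z S) : R = S := by
  ext v
  obtain ⟨h, hv⟩ := hS.1 v
  have := hR.2 ⟨S v, h⟩
  rwa [hv] at this

theorem isResolventAt_resolventOp {H : E →ₗ.[ℂ] E} {z : ℂ}
    (h : ∃ R : E →L[ℂ] E, IsResolventAt H z R) : IsResolventAt H z (resolventOp H z) := by
  rw [resolventOp, dif_pos h]
  exact h.choose_spec

/-- The first resolvent identity `R_w - R_z = (z - w) R_w R_z`. -/
theorem IsResolventAt.sub_eq {H : E →ₗ.[ℂ] E} {z w : ℂ} {R S : E →L[ℂ] E}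
    (hR : IsResolventAt H z R) (hS : IsResolventAt H w S) : S - R = (z - w) • (S * R) := by
  ext v
  obtain ⟨h, hv⟩ := hR.1 v
  have h2 := hS.2 ⟨R v, h⟩
  have h3 : w • R v - H ⟨R v, h⟩ = v - (z - w) • R v := by
    rw [← sub_eq_of_eq_add (sub_eq_iff_eq_add'.1 hv)]
    module
  simp only [h3, map_sub, map_smul] at h2
  change S v - R v = (z - w) • S (R v)
  exact sub_eq_of_eq_add (sub_eq_iff_eq_add'.1 h2)

theorem IsResolventAt.commute {H : E →ₗ.[ℂ] E} {z w : ℂ} {R S : E →L[ℂ] E}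
    (hR : IsResolventAt H z R) (hS : IsResolventAt H w S) : Commute R S := by
  rcases eq_or_ne z w with rfl | hzw
  · rw [hR.unique hS]
  · have h1 := hR.sub_eq hS
    have h2 := hS.sub_eq hR
    have h3 : (z - w) • (R * S) = (z - w) • (S * R) := by
      rw [← h1, ← neg_sub R S, h2, ← neg_smul, neg_sub]
    exact smul_right_injective _ (sub_ne_zero.2 hzw) h3

/-- If `c = (w - z)⁻¹` is a regular value of the resolvent at `w`, then `z` is a regular value of
the operator itself: `(z - H)⁻¹ = (w - z)⁻¹ R (c - R)⁻¹`. -/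
theorem IsResolventAt.inv_sub_mem_spectrum {H : E →ₗ.[ℂ] E} {z w : ℂ} {R : E →L[ℂ] E}
    (hR : IsResolventAt H w R) (hz : z ∈ opSpectrum H) : (w - z)⁻¹ ∈ spectrum ℂ R := by
  have hwz : w - z ≠ 0 := by
    intro h
    rw [sub_eq_zero.1 h] at hR
    exact hz ⟨R, hR⟩
  rw [spectrum.mem_iff]
  rintro ⟨u, hu⟩
  apply hz
  set T : E →L[ℂ] E := ((u⁻¹ : (E →L[ℂ] E)ˣ) : E →L[ℂ] E) with hT
  have hu' : ∀ v, (u : E →L[ℂ] E) v = (w - z)⁻¹ • v - R v := by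
    intro v
    rw [hu]
    simp [Algebra.algebraMap_eq_smul_one]
  have hTr : ∀ v, (w - z)⁻¹ • T v - R (T v) = v := by
    intro v
    rw [← hu', ← mul_apply_eq_comp, hT, u.mul_inv, one_apply_eq_self]
  have hTl : ∀ v, T ((w - z)⁻¹ • v - R v) = v := by
    intro v
    rw [← hu', ← mul_apply_eq_comp, hT, u.inv_mul, one_apply_eq_self]
  refine ⟨(w - z)⁻¹ • (R * T), fun v => ?_, fun x => ?_⟩
  · obtain ⟨h, hv⟩ := hR.1 (T v)
    refine ⟨H.domain.smul_mem _ h, ?_⟩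
    have h2 : H ⟨(w - z)⁻¹ • R (T v), H.domain.smul_mem _ h⟩
        = (w - z)⁻¹ • H ⟨R (T v), h⟩ := H.map_smul (w - z)⁻¹ ⟨R (T v), h⟩
    have h3 : H ⟨R (T v), h⟩ = w • R (T v) - T v :=
      (sub_eq_of_eq_add (sub_eq_iff_eq_add'.1 hv)).symm
    change z • ((w - z)⁻¹ • R (T v)) - H ⟨(w - z)⁻¹ • R (T v), H.domain.smul_mem _ h⟩ = v
    rw [h2, h3]
    nth_rewrite 4 [← hTr v]
    match_scalars <;> field_simp
    ring
  · have h1 := hR.2 x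
    set y := w • (x : E) - H x with hy
    have h2 : z • (x : E) - H x = (w - z) • ((w - z)⁻¹ • y - R y) := by
      rw [h1, hy]
      match_scalars <;> field_simp
      ring
    rw [h2]
    change (w - z)⁻¹ • R (T ((w - z) • ((w - z)⁻¹ • y - R y))) = x
    rw [map_smul, map_smul, hTl, h1, smul_smul, inv_mul_cancel₀ hwz, one_smul]

variable [CompleteSpace E] {H : E →ₗ.[ℂ] E}

theorem inner_apply_left_of_isSelfAdjoint (hH : IsSelfAdjoint H) (u v : H.domain) :
    inner ℂ (H u) (v : E) = inner ℂ (u : E) (H v) := by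
  have h := LinearPMap.adjoint_isFormalAdjoint hH.dense_domain
  rw [LinearPMap.isSelfAdjoint_def.1 hH] at h
  exact h u v

/-- The basic estimate for nonreal `z`: `Im ⟨u, (z - H) u⟩ = Im z ‖u‖²`, as `⟨u, H u⟩` is real. -/
theorem abs_im_mul_norm_le (hH : IsSelfAdjoint H) (z : ℂ) (u : H.domain) :
    |z.im| * ‖(u : E)‖ ≤ ‖z • (u : E) - H u‖ := by
  have h1 : (inner ℂ (u : E) (H u)).im = 0 := by
    rw [← Complex.conj_eq_iff_im, inner_conj_symm]
    exact inner_apply_left_of_isSelfAdjoint hH u u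
  have h2 : (inner ℂ (u : E) (z • (u : E) - H u)).im = z.im * ‖(u : E)‖ ^ 2 := by
    rw [inner_sub_right, inner_smul_right, inner_self_eq_norm_sq_to_K, Complex.sub_im, h1]
    norm_cast
    simp [-Complex.ofReal_pow]
  have h3 : |z.im| * ‖(u : E)‖ ^ 2 ≤ ‖(u : E)‖ * ‖z • (u : E) - H u‖ := by
    calc |z.im| * ‖(u : E)‖ ^ 2 = |(inner ℂ (u : E) (z • (u : E) - H u)).im| := by
          rw [h2, abs_mul, abs_of_nonneg (sq_nonneg ‖(u : E)‖)]
      _ ≤ ‖inner ℂ (u : E) (z • (u : E) - H u)‖ := Complex.abs_im_le_norm _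
      _ ≤ _ := norm_inner_le_norm _ _
  rcases (norm_nonneg (u : E)).eq_or_lt with h | h
  · rw [← h, mul_zero]; positivity
  · refine le_of_mul_le_mul_left ?_ h
    linarith

/-- A self-adjoint operator has a bounded resolvent at every nonreal point: `z - H` is bounded
below by `|Im z|`, its range is closed because the graph of `H` is, and dense because a vector
orthogonal to it would be an eigenvector of `H† = H` for the nonreal eigenvalue `z̄`. -/
theorem exists_isResolventAt (hH : IsSelfAdjoint H) {z : ℂ} (hz : z.im ≠ 0) :
    ∃ R : E →L[ℂ] E, IsResolventAt H z R := by
  have hcl : IsClosed (H.graph : Set (E × E)) := hH.isClosed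
  have : CompleteSpace H.graph := hcl.completeSpace_coe
  let L : H.graph →L[ℂ] E :=
    (z • ContinuousLinearMap.fst ℂ E E - ContinuousLinearMap.snd ℂ E E).comp H.graph.subtypeL
  have hL : ∀ u : H.domain, ∃ g : H.graph, g.1 = ((u : E), H u) ∧ L g = z • (u : E) - H u :=
    fun u => ⟨⟨(u, H u), H.mem_graph u⟩, rfl, rfl⟩
  have hg : ∀ g : H.graph, ∃ u : H.domain, g.1 = ((u : E), H u) := by
    intro g
    obtain ⟨u, h1, h2⟩ := LinearPMap.mem_graph_iff _ |>.1 g.2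
    exact ⟨u, Prod.ext h1.symm h2.symm⟩
  have hpos : 0 < |z.im| := abs_pos.2 hz
  -- the graph norm is controlled by `‖H u‖ ≤ ‖z‖ ‖u‖ + ‖(z - H) u‖`
  have hlow : ∀ g : H.graph, ‖g‖ ≤ ((1 + ‖z‖) / |z.im| + 1) * ‖L g‖ := by
    intro g
    obtain ⟨u, hu⟩ := hg g
    have e1 : L g = z • (u : E) - H u := by
      change z • g.1.1 - g.1.2 = _
      rw [hu]
    have e2 : ‖g‖ = max ‖(u : E)‖ ‖H u‖ := by
      change ‖g.1‖ = _
      rw [hu]; rfl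
    have e3 := abs_im_mul_norm_le hH z u
    rw [← e1] at e3
    have e4 : ‖(u : E)‖ ≤ ‖L g‖ / |z.im| := by
      rw [le_div_iff₀ hpos]; linarith
    have e5 : ‖H u‖ ≤ ‖z‖ * ‖(u : E)‖ + ‖L g‖ := by
      have : H u = z • (u : E) - L g := by rw [e1]; abel
      rw [this, ← norm_smul]
      exact norm_sub_le _ _
    have e6 : ‖z‖ * ‖(u : E)‖ ≤ ‖z‖ * (‖L g‖ / |z.im|) := by gcongr
    have e7 : ((1 + ‖z‖) / |z.im| + 1) * ‖L g‖
        = ‖L g‖ / |z.im| + ‖z‖ * (‖L g‖ / |z.im|) + ‖L g‖ := by field_simp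
    have e8 : 0 ≤ ‖z‖ * (‖L g‖ / |z.im|) := by positivity
    have e9 : 0 ≤ ‖L g‖ / |z.im| := by positivity
    rw [e2, e7]
    refine max_le ?_ ?_ <;> linarith [norm_nonneg (L g)]
  obtain ⟨K, hK⟩ : ∃ K, AntilipschitzWith K L :=
    ⟨⟨_, by positivity⟩, L.antilipschitz_of_bound hlow⟩
  have hker : LinearMap.ker (L : H.graph →ₗ[ℂ] E) = ⊥ := LinearMap.ker_eq_bot.2 hK.injective
  have hrange : LinearMap.range (L : H.graph →ₗ[ℂ] E) = ⊤ := by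
    have hclr : IsClosed (LinearMap.range (L : H.graph →ₗ[ℂ] E) : Set E) :=
      hK.isClosed_range L.uniformContinuous
    have : CompleteSpace (LinearMap.range (L : H.graph →ₗ[ℂ] E)) := hclr.completeSpace_coe
    rw [← Submodule.orthogonal_eq_bot_iff, Submodule.eq_bot_iff]
    intro v hv
    have hv' : ∀ u : H.domain, inner ℂ v (z • (u : E) - H u) = 0 := by
      intro u
      obtain ⟨g, -, hg⟩ := hL u
      rw [← hg]
      exact (Submodule.mem_orthogonal' _ _).1 hv _ ⟨g, rfl⟩
    have hw : ∀ u : H.domain, inner ℂ ((starRingEnd ℂ z) • v) (u : E) = inner ℂ v (H u) := by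
      intro u
      have := hv' u
      rw [inner_sub_right, inner_smul_right, sub_eq_zero] at this
      rw [inner_smul_left, Complex.conj_conj, this]
    have hdom := LinearPMap.mem_adjoint_domain_of_exists v ⟨_, hw⟩
    have happ := LinearPMap.adjoint_apply_eq hH.dense_domain ⟨v, hdom⟩ hw
    -- `H† = H` cannot be rewritten in `hdom`, on which `happ` depends, so `T` stands for `H†`
    have key : ∀ T : E →ₗ.[ℂ] E, T = H → ∀ h : v ∈ T.domain,
        T ⟨v, h⟩ = (starRingEnd ℂ z) • v → v = 0 := by
      rintro T rfl h hT
      have := abs_im_mul_norm_le hH (starRingEnd ℂ z) ⟨v, h⟩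
      rw [hT, sub_self, norm_zero, Complex.conj_im, abs_neg] at this
      exact norm_eq_zero.1 (le_antisymm (by nlinarith [norm_nonneg v]) (norm_nonneg v))
    exact key _ (LinearPMap.isSelfAdjoint_def.1 hH) hdom happ
  let e := ContinuousLinearEquiv.ofBijective L hker hrange
  refine ⟨((ContinuousLinearMap.fst ℂ E E).comp H.graph.subtypeL).comp (e.symm : E →L[ℂ] H.graph),
    fun v => ?_, fun u => ?_⟩
  · obtain ⟨u, hu⟩ := hg (e.symm v)
    have h1 : L (e.symm v) = v := e.apply_symm_apply v
    have h2 : L (e.symm v) = z • (u : E) - H u := by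
      change z • (e.symm v).1.1 - (e.symm v).1.2 = _
      rw [hu]
    change ∃ h : (e.symm v).1.1 ∈ H.domain, z • (e.symm v).1.1 - H ⟨(e.symm v).1.1, h⟩ = v
    simp only [hu]
    exact ⟨u.2, h2.symm.trans h1⟩
  · obtain ⟨g, h1, h2⟩ := hL u
    rw [← h2]
    have h3 : e.symm (L g) = g := e.symm_apply_apply g
    change (e.symm (L g)).1.1 = _
    rw [h3, h1]

theorem isResolventAt_resolventOp_of_im_ne_zero (hH : IsSelfAdjoint H) {z : ℂ} (hz : z.im ≠ 0) :
    IsResolventAt H z (resolventOp H z) :=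
  isResolventAt_resolventOp (exists_isResolventAt hH hz)

theorem star_resolventOp (hH : IsSelfAdjoint H) {z : ℂ} (hz : z.im ≠ 0) :
    star (resolventOp H z) = resolventOp H (starRingEnd ℂ z) := by
  rw [ContinuousLinearMap.star_eq_adjoint]
  symm
  rw [ContinuousLinearMap.eq_adjoint_iff]
  intro x y
  obtain ⟨h1, hx⟩ := (isResolventAt_resolventOp_of_im_ne_zero hH
    (z := starRingEnd ℂ z) (by simpa using hz)).1 x
  obtain ⟨h2, hy⟩ := (isResolventAt_resolventOp_of_im_ne_zero hH hz).1 y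
  set a := resolventOp H (starRingEnd ℂ z) x
  set b := resolventOp H z y
  have := inner_apply_left_of_isSelfAdjoint hH ⟨a, h1⟩ ⟨b, h2⟩
  rw [← hx, ← hy, inner_sub_left, inner_sub_right, this, inner_smul_left, inner_smul_right,
    Complex.conj_conj]

end Resolvent

/-! ### The functional calculus obtained from the resolvent at `i` -/

section Calculus

/-- The function `x ↦ (z - x)⁻¹` as an element of `C₀(ℝ)`, for nonreal `z`; for real `z` it is given
the value `0`. -/
def cauchyKernel (z : ℂ) : C₀(ℝ, ℂ) :=
  if h : z.im ≠ 0 then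
    { toFun := fun x => (z - x)⁻¹
      continuous_toFun := by
        refine Continuous.inv₀ (by fun_prop) fun x hx => h ?_
        rw [sub_eq_zero.1 hx, Complex.ofReal_im]
      zero_at_infty' := by
        refine tendsto_inv₀_cobounded.comp ?_
        rw [← tendsto_norm_atTop_iff_cobounded, ← Metric.cobounded_eq_cocompact]
        refine tendsto_atTop_mono (f := fun x : ℝ => ‖x‖ - ‖z‖) (fun x => ?_)
          (tendsto_atTop_add_const_right _ _ tendsto_norm_cobounded_atTop)
        have := norm_sub_norm_le (x : ℂ) z
        rwa [Complex.norm_real, norm_sub_rev] at this }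
  else 0

theorem cauchyKernel_apply {z : ℂ} (hz : z.im ≠ 0) (x : ℝ) : cauchyKernel z x = (z - x)⁻¹ := by
  rw [cauchyKernel, dif_pos hz]
  rfl

theorem sub_ofReal_ne_zero {z : ℂ} (hz : z.im ≠ 0) (x : ℝ) : z - x ≠ 0 := fun h =>
  hz (by rw [sub_eq_zero.1 h, Complex.ofReal_im])

theorem norm_zeroAtInfty_le {f : C₀(ℝ, ℂ)} {C : ℝ} (hC : 0 ≤ C) (h : ∀ x, ‖f x‖ ≤ C) : ‖f‖ ≤ C :=
  (BoundedContinuousFunction.norm_le hC).2 h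

theorem norm_apply_le_norm (f : C₀(ℝ, ℂ)) (x : ℝ) : ‖f x‖ ≤ ‖f‖ :=
  f.toBCF.norm_coe_le_norm x

theorem norm_cauchyKernel_le (z : ℂ) : ‖cauchyKernel z‖ ≤ |z.im|⁻¹ := by
  by_cases hz : z.im ≠ 0
  · refine norm_zeroAtInfty_le (by positivity) fun x => ?_
    rw [cauchyKernel_apply hz, norm_inv]
    refine inv_anti₀ (abs_pos.2 hz) ?_
    have := Complex.abs_im_le_norm (z - x)
    rwa [Complex.sub_im, Complex.ofReal_im, sub_zero] at this
  · rw [cauchyKernel, dif_neg hz, norm_zero]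
    positivity

theorem continuousOn_cauchyKernel : ContinuousOn cauchyKernel {z | z.im ≠ 0} := by
  intro w hw
  rw [ContinuousWithinAt, tendsto_iff_norm_sub_tendsto_zero]
  have hlim : Tendsto (fun z : ℂ => ‖w - z‖ * (|z.im|⁻¹ * |w.im|⁻¹))
      (𝓝[{z | z.im ≠ 0}] w) (𝓝 0) := by
    have : ContinuousAt (fun z : ℂ => ‖w - z‖ * (|z.im|⁻¹ * |w.im|⁻¹)) w := by
      have h0 : |w.im| ≠ 0 := abs_ne_zero.2 hw
      have hc : ContinuousAt (fun z : ℂ => |z.im|) w := by fun_prop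
      exact (by fun_prop : ContinuousAt (fun z : ℂ => ‖w - z‖) w).mul
        ((hc.inv₀ h0).mul continuousAt_const)
    have h := this.tendsto
    rw [sub_self, norm_zero, zero_mul] at h
    exact h.mono_left nhdsWithin_le_nhds
  refine squeeze_zero' (Eventually.of_forall fun _ => norm_nonneg _) ?_ hlim
  filter_upwards [self_mem_nhdsWithin] with z hz
  -- the resolvent identity for the scalar kernels
  have : cauchyKernel z - cauchyKernel w = (w - z) • (cauchyKernel z * cauchyKernel w) := by
    ext x
    have h1 := sub_ofReal_ne_zero hz x
    have h2 := sub_ofReal_ne_zero hw x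
    simp only [ZeroAtInftyContinuousMap.sub_apply, ZeroAtInftyContinuousMap.smul_apply,
      ZeroAtInftyContinuousMap.mul_apply, cauchyKernel_apply hz, cauchyKernel_apply hw, smul_eq_mul]
    field_simp
    ring
  rw [this, norm_smul]
  gcongr
  exact (norm_mul_le _ _).trans (mul_le_mul (norm_cauchyKernel_le z) (norm_cauchyKernel_le w)
    (norm_nonneg _) (by positivity))

/-- The point evaluation at `x` as a bounded functional on `C₀(ℝ)`. -/
def evalC0 (x : ℝ) : C₀(ℝ, ℂ) →L[ℂ] ℂ :=
  LinearMap.mkContinuous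
    { toFun := fun f => f x
      map_add' := fun _ _ => rfl
      map_smul' := fun _ _ => rfl } 1 fun f => by
        rw [one_mul]
        exact norm_apply_le_norm f x

/-- On a set `K` all of whose nonzero points are of the form `(i - s)⁻¹` with `s` real, the function
`w ↦ f (i - w⁻¹)`, extended by `0` to `w = 0`, is continuous for every `f ∈ C₀(ℝ)`. -/
theorem continuous_pullback {K : Set ℂ} (hK : ∀ w ∈ K, w ≠ 0 → (w⁻¹).im = 1) (f : C₀(ℝ, ℂ)) :
    Continuous fun w : K => if (w : ℂ) = 0 then (0 : ℂ) else f (-((w : ℂ)⁻¹).re) := by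
  rw [continuous_iff_continuousAt]
  rintro ⟨w, hw⟩
  by_cases h0 : w = 0
  · subst h0
    rw [ContinuousAt, if_pos rfl]
    have hf := f.zero_at_infty'
    rw [← Metric.cobounded_eq_cocompact] at hf
    rw [Metric.tendsto_nhds]
    intro ε hε
    -- `|Re w⁻¹| ≥ |w⁻¹| - 1` on `K`, so `Re w⁻¹` tends to infinity as `w → 0` in `K`
    have h1 : Tendsto (fun w : ℂ => ‖w⁻¹‖ - 1) (𝓝[≠] 0) atTop :=
      tendsto_atTop_add_const_right _ _
        (tendsto_norm_cobounded_atTop.comp tendsto_inv₀_nhdsNE_zero)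
    rw [Metric.tendsto_nhds] at hf
    have h2 := hf ε hε
    rw [← comap_norm_atTop, Filter.eventually_comap] at h2
    obtain ⟨N, hN⟩ := eventually_atTop.1 h2
    have h3 := h1.eventually (eventually_ge_atTop N)
    rw [eventually_nhdsWithin_iff] at h3
    have h4 : Tendsto (fun w : K => (w : ℂ)) (𝓝 ⟨0, hw⟩) (𝓝 0) := continuous_subtype_val.tendsto _
    filter_upwards [h4.eventually h3] with w' h5
    by_cases h6 : (w' : ℂ) = 0
    · rw [if_pos h6, dist_self]
      exact hε
    · rw [if_neg h6]
      refine hN ‖-((w' : ℂ)⁻¹).re‖ ?_ _ rfl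
      have h7 := Complex.norm_le_abs_re_add_abs_im (w' : ℂ)⁻¹
      rw [hK _ w'.2 h6, abs_one] at h7
      rw [norm_neg, Real.norm_eq_abs]
      linarith [h5 h6]
  · have h1 : ContinuousAt (fun w : K => f (-((w : ℂ)⁻¹).re)) ⟨w, hw⟩ := by
      refine f.continuous.continuousAt.comp ?_
      refine (Complex.continuous_re.continuousAt.comp ?_).neg
      exact continuous_subtype_val.continuousAt.inv₀ h0
    refine h1.congr ?_
    have : ∀ᶠ w' : K in 𝓝 ⟨w, hw⟩, (w' : ℂ) ≠ 0 :=
      continuous_subtype_val.continuousAt.eventually_ne h0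
    filter_upwards [this] with w' h2
    rw [if_neg h2]

/-- The map `f ↦ (w ↦ f (i - w⁻¹))` from `C₀(ℝ)` to the continuous functions on a compact subset of
the circle `{(i - s)⁻¹ | s ∈ ℝ} ∪ {0}`, the image function being `0` at `w = 0`. The real number
`i - w⁻¹` is written as `-Re w⁻¹`. -/
def pullback {K : Set ℂ} [CompactSpace K] (hK : ∀ w ∈ K, w ≠ 0 → (w⁻¹).im = 1) :
    C₀(ℝ, ℂ) →L[ℂ] C(K, ℂ) :=
  LinearMap.mkContinuous
    { toFun := fun f => ⟨_, continuous_pullback hK f⟩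
      map_add' := fun f g => by
        ext w
        by_cases h : (w : ℂ) = 0 <;> simp [h]
      map_smul' := fun c f => by
        ext w
        by_cases h : (w : ℂ) = 0 <;> simp [h] } 1 fun f => by
    rw [one_mul, ContinuousMap.norm_le _ (norm_nonneg f)]
    intro w
    by_cases h : (w : ℂ) = 0
    · simp [h]
    · simpa [h] using norm_apply_le_norm f _

theorem pullback_apply_of_ne_zero {K : Set ℂ} [CompactSpace K]
    (hK : ∀ w ∈ K, w ≠ 0 → (w⁻¹).im = 1) (f : C₀(ℝ, ℂ)) (w : K) (hw : (w : ℂ) ≠ 0) :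
    pullback hK f w = f (-((w : ℂ)⁻¹).re) :=
  if_neg hw

theorem pullback_cauchyKernel_mul {K : Set ℂ} [CompactSpace K]
    (hK : ∀ w ∈ K, w ≠ 0 → (w⁻¹).im = 1) {z : ℂ} (hz : z.im ≠ 0) (w : K) :
    pullback hK (cauchyKernel z) w * (1 + (z - Complex.I) * w) = w := by
  by_cases h : (w : ℂ) = 0
  · have : pullback hK (cauchyKernel z) w = 0 := if_pos h
    rw [this, h, zero_mul]
  · rw [pullback_apply_of_ne_zero hK _ _ h, cauchyKernel_apply hz]
    set s : ℝ := -((w : ℂ)⁻¹).re with hs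
    have h1 : (w : ℂ)⁻¹ = Complex.I - s := by
      apply Complex.ext
      · simp [hs]
      · simp [hK _ w.2 h]
    have h2 := sub_ofReal_ne_zero hz s
    have h3 : (1 + (z - Complex.I) * w : ℂ) = (z - s) * w := by
      have : (w : ℂ) * (w : ℂ)⁻¹ = 1 := mul_inv_cancel₀ h
      rw [h1] at this
      rw [← this]
      ring
    rw [h3, ← mul_assoc, inv_mul_cancel₀ h2, one_mul]

variable {E : Type*} [NormedAddCommGroup E] [InnerProductSpace ℂ E]

/-- The operator `1 + (z - w) R_w = (z - H) R_w` is inverted by `1 + (w - z) R_z`. -/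
theorem IsResolventAt.one_add_mul_one_add {H : E →ₗ.[ℂ] E} {z w : ℂ} {R S : E →L[ℂ] E}
    (hR : IsResolventAt H z R) (hS : IsResolventAt H w S) :
    (1 + (z - w) • S) * (1 + (w - z) • R) = 1 := by
  have h : S = R + (z - w) • (S * R) := by rw [← hR.sub_eq hS]; abel
  have h2 : (1 + (z - w) • S) * (1 + (w - z) • R)
      = 1 + (z - w) • (S - (R + (z - w) • (S * R))) := by
    simp only [mul_add, add_mul, mul_one, one_mul, smul_mul_smul_comm, smul_sub, smul_add,
      smul_smul]
    rw [← neg_sub z w]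
    module
  rw [h2, ← h, sub_self, smul_zero, add_zero]

variable [CompleteSpace E] {H : E →ₗ.[ℂ] E}

theorem isStarNormal_resolventOp (hH : IsSelfAdjoint H) :
    IsStarNormal (resolventOp H Complex.I) := by
  constructor
  rw [star_resolventOp hH (by simp)]
  exact (isResolventAt_resolventOp_of_im_ne_zero hH (by simp)).commute
    (isResolventAt_resolventOp_of_im_ne_zero hH (by simp))

/-- The spectrum of `R_i` lies on the circle `{(i - s)⁻¹ | s ∈ ℝ} ∪ {0}`: if `z = i - w⁻¹` is not
real, then `w - R_i = w (1 + (z - i) R_i)` is invertible. -/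
theorem im_inv_eq_one_of_mem_spectrum (hH : IsSelfAdjoint H) :
    ∀ w ∈ spectrum ℂ (resolventOp H Complex.I), w ≠ 0 → (w⁻¹).im = 1 := by
  intro w hw h0
  by_contra hne
  set z := Complex.I - w⁻¹ with hz
  have hzim : z.im ≠ 0 := by
    rw [hz, Complex.sub_im, Complex.I_im]
    intro h
    exact hne (by linarith)
  have hR := isResolventAt_resolventOp_of_im_ne_zero hH hzim
  have hS := isResolventAt_resolventOp_of_im_ne_zero hH (z := Complex.I) (by simp)
  have h1 := hR.one_add_mul_one_add hS
  have h2 := hS.one_add_mul_one_add hR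
  set R := resolventOp H z
  set S := resolventOp H Complex.I
  have hu : IsUnit (1 + (z - Complex.I) • S) := ⟨⟨_, _, h1, h2⟩, rfl⟩
  rw [spectrum.mem_iff] at hw
  apply hw
  have h3 : algebraMap ℂ (E →L[ℂ] E) w - S = w • (1 + (z - Complex.I) • S) := by
    rw [Algebra.algebraMap_eq_smul_one, smul_add, smul_smul, hz]
    have : w * (Complex.I - w⁻¹ - Complex.I) = -1 := by field_simp; ring
    rw [this, neg_one_smul, sub_eq_add_neg]
  rw [h3]
  exact hu.smul (Units.mk0 w h0)

/-- The continuous functional calculus of a self-adjoint operator `H` on `C₀(ℝ)`, obtained from the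
continuous functional calculus of the bounded normal operator `(i - H)⁻¹`. -/
def resolventCalculus (hH : IsSelfAdjoint H) : C₀(ℝ, ℂ) →L[ℂ] (E →L[ℂ] E) :=
  (⟨(cfcHom (isStarNormal_resolventOp hH) :
      C(spectrum ℂ (resolventOp H Complex.I), ℂ) →⋆ₐ[ℂ] (E →L[ℂ] E)).toAlgHom.toLinearMap,
    cfcHom_continuous (isStarNormal_resolventOp hH)⟩ :
      C(spectrum ℂ (resolventOp H Complex.I), ℂ) →L[ℂ] (E →L[ℂ] E)).comp
    (pullback (im_inv_eq_one_of_mem_spectrum hH))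

theorem resolventCalculus_apply (hH : IsSelfAdjoint H) (f : C₀(ℝ, ℂ)) :
    resolventCalculus hH f = cfcHom (isStarNormal_resolventOp hH)
      (pullback (im_inv_eq_one_of_mem_spectrum hH) f) :=
  rfl

/-- Both sides are solutions `X` of `X (1 + (z - i) R_i) = R_i`, where the factor on the right is
invertible. -/
theorem resolventCalculus_cauchyKernel (hH : IsSelfAdjoint H) {z : ℂ} (hz : z.im ≠ 0) :
    resolventCalculus hH (cauchyKernel z) = resolventOp H z := by
  have hR := isResolventAt_resolventOp_of_im_ne_zero hH hz
  have hS := isResolventAt_resolventOp_of_im_ne_zero hH (z := Complex.I) (by simp)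
  have h1 := hR.one_add_mul_one_add hS
  have hn := isStarNormal_resolventOp hH
  have h3 : resolventCalculus hH (cauchyKernel z)
      * (1 + (z - Complex.I) • resolventOp H Complex.I) = resolventOp H Complex.I := by
    have h4 : pullback (im_inv_eq_one_of_mem_spectrum hH) (cauchyKernel z) *
        (1 + (z - Complex.I) • (ContinuousMap.id ℂ).restrict _)
        = (ContinuousMap.id ℂ).restrict (spectrum ℂ (resolventOp H Complex.I)) := by
      ext w
      exact pullback_cauchyKernel_mul _ hz w
    have h5 := congrArg (cfcHom hn) h4
    rwa [map_mul, map_add, map_one, map_smul, cfcHom_id hn, ← resolventCalculus_apply hH] at h5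
  have h6 := congrArg (· * (1 + (Complex.I - z) • resolventOp H z)) h3
  simp only [mul_assoc, h1, mul_one] at h6
  rw [h6]
  have h7 := hR.sub_eq hS
  rw [mul_add, mul_one, mul_smul_comm, ← neg_sub z, neg_smul, ← h7]
  abel

/-- One half of the spectral mapping theorem for `resolventCalculus`. -/
theorem image_subset_spectrum_resolventCalculus (hH : IsSelfAdjoint H) (f : C₀(ℝ, ℂ)) :
    f '' {s : ℝ | (s : ℂ) ∈ opSpectrum H} ⊆ spectrum ℂ (resolventCalculus hH f) := by
  rintro _ ⟨s, hs, rfl⟩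
  rw [resolventCalculus_apply, cfcHom_map_spectrum]
  have hS := isResolventAt_resolventOp_of_im_ne_zero hH (z := Complex.I) (by simp)
  have h0 : (Complex.I - s)⁻¹ ≠ 0 := inv_ne_zero (sub_ofReal_ne_zero (by simp) s)
  refine ⟨⟨_, hS.inv_sub_mem_spectrum hs⟩, ?_⟩
  rw [pullback_apply_of_ne_zero _ _ _ h0]
  simp

end Calculus

/-! ### The Cauchy–Pompeiu formula -/

section CauchyPompeiu

/-- The `∂/∂z̄` derivative of the difference quotient `(g z - g 0) / z`, up to the factor `2i`. -/
theorem fderiv_dslope_zero {g : ℂ → ℂ} (hg : Differentiable ℝ g) {z : ℂ} (hz : z ≠ 0) :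
    DifferentiableAt ℝ (dslope g 0) z ∧
      Complex.I • fderiv ℝ (dslope g 0) z 1 - fderiv ℝ (dslope g 0) z Complex.I =
        (Complex.I * fderiv ℝ g z 1 - fderiv ℝ g z Complex.I) * z⁻¹ := by
  have h1 : dslope g 0 =ᶠ[𝓝 z] fun ζ => ζ⁻¹ * (g ζ - g 0) := by
    filter_upwards [isOpen_ne.mem_nhds hz] with ζ hζ
    rw [dslope_of_ne _ hζ, slope_def_field, sub_zero, div_eq_inv_mul]
  have h2 : HasFDerivAt (fun ζ : ℂ => ζ⁻¹) _ z :=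
    (hasDerivAt_inv hz).hasFDerivAt.restrictScalars ℝ
  have h3 := ((h2.mul ((hg z).hasFDerivAt.sub_const (g 0)))).congr_of_eventuallyEq h1
  refine ⟨h3.differentiableAt, ?_⟩
  rw [h3.fderiv]
  simp
  ring

/-- The integral of `dz / z` around the square with corners `±R ± iR`, its four sides being combined
into one integral by `1/(t - iR) - 1/(t + iR) + i/(R + it) - i/(-R + it) = 4iR/(R² + t²)`. -/
theorem integral_boundary_kernel {R : ℝ} (hR : 0 < R) :
    ∫ t : ℝ in -R..R, (4 * Complex.I * (R / (R ^ 2 + t ^ 2) : ℝ)) = 2 * Real.pi * Complex.I := by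
  rw [intervalIntegral.integral_const_mul, intervalIntegral.integral_ofReal]
  rw [integral_div_sq_add_sq, neg_div, div_self hR.ne', Real.arctan_neg, Real.arctan_one]
  push_cast
  ring

/-- The Cauchy–Pompeiu formula at the origin, for a function that vanishes at infinity and is
complex differentiable at the origin. -/
theorem integral_dbar_mul_inv_zero {g : ℂ → ℂ} (hg : Differentiable ℝ g)
    (h0 : DifferentiableAt ℂ g 0) (hlim : Tendsto g (cocompact ℂ) (𝓝 0))
    (hint : Integrable fun p : ℝ × ℝ =>
      (Complex.I * fderiv ℝ g (p.1 + p.2 * Complex.I) 1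
        - fderiv ℝ g (p.1 + p.2 * Complex.I) Complex.I) * (p.1 + p.2 * Complex.I : ℂ)⁻¹) :
    ∫ p : ℝ × ℝ, (Complex.I * fderiv ℝ g (p.1 + p.2 * Complex.I) 1
        - fderiv ℝ g (p.1 + p.2 * Complex.I) Complex.I) * (p.1 + p.2 * Complex.I : ℂ)⁻¹
      = -(2 * Real.pi * Complex.I * g 0) := by
  set ψ : ℝ × ℝ → ℂ := fun p => (Complex.I * fderiv ℝ g (p.1 + p.2 * Complex.I) 1
        - fderiv ℝ g (p.1 + p.2 * Complex.I) Complex.I) * (p.1 + p.2 * Complex.I : ℂ)⁻¹ with hψ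
  set F := dslope g 0 with hF
  have hFc : Continuous F := by
    rw [continuous_iff_continuousAt]
    intro z
    rcases eq_or_ne z 0 with rfl | hz
    · exact continuousAt_dslope_same.2 h0
    · exact (continuousAt_dslope_of_ne hz).2 (hg z).continuousAt
  set φ : ℂ → ℂ := fun z => Complex.I • fderiv ℝ F z 1 - fderiv ℝ F z Complex.I with hφ
  have hφψ : (fun p : ℝ × ℝ => φ (p.1 + p.2 * Complex.I)) =ᵐ[volume] ψ := by
    have : ∀ᵐ p : ℝ × ℝ, p ≠ 0 := compl_mem_ae_iff.2 (measure_singleton _)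
    filter_upwards [this] with p hp
    refine (fderiv_dslope_zero hg ?_).2
    intro h
    apply hp
    rw [← Complex.mk_eq_add_mul_I] at h
    exact Prod.ext (congrArg Complex.re h) (congrArg Complex.im h)
  have hφ2 : Integrable fun p : ℝ × ℝ => φ (p.1 + p.2 * Complex.I) := hint.congr hφψ.symm
  have hφi : Integrable φ := by
    rw [← Complex.volume_preserving_equiv_real_prod.symm.integrable_comp_emb
      Complex.measurableEquivRealProd.symm.measurableEmbedding]
    refine hφ2.congr (Eventually.of_forall fun p => ?_)
    change φ _ = φ _
    rw [← Complex.mk_eq_add_mul_I]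
    rfl
  -- the Green formula on the square of half-side `R`
  have key : ∀ R : ℝ, 0 < R → ∫ t : ℝ in -R..R, (F (t - R * Complex.I) - F (t + R * Complex.I)
      + Complex.I * F (R + t * Complex.I) - Complex.I * F (-R + t * Complex.I))
      = ∫ p in Set.Ioc (-R) R ×ˢ Set.Ioc (-R) R, φ (p.1 + p.2 * Complex.I) := by
    intro R hR
    have h1 := Complex.integral_boundary_rect_of_hasFDerivAt_real_off_countable F (fderiv ℝ F)
      (-R - R * Complex.I) (R + R * Complex.I) {0} (Set.countable_singleton 0) hFc.continuousOn
      (fun x hx => (fderiv_dslope_zero hg hx.2).1.hasFDerivAt) hφi.integrableOn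
    have hle : -R ≤ R := by linarith
    simp only [Complex.add_re, Complex.sub_re, Complex.neg_re, Complex.ofReal_re, Complex.mul_re,
      Complex.I_re, mul_zero, Complex.ofReal_im, Complex.I_im, sub_self, sub_zero, add_zero,
      Complex.add_im, Complex.sub_im, Complex.neg_im, Complex.mul_im, mul_one, zero_add, neg_zero,
      zero_sub, smul_eq_mul, Complex.ofReal_neg] at h1
    have hsp : ∫ p in Set.Ioc (-R) R ×ˢ Set.Ioc (-R) R, φ (p.1 + p.2 * Complex.I)
        = ∫ x in Set.Ioc (-R) R, ∫ y in Set.Ioc (-R) R, φ (x + y * Complex.I) :=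
      setIntegral_prod (fun p : ℝ × ℝ => φ (p.1 + p.2 * Complex.I)) hφ2.integrableOn
    rw [hsp]
    rw [intervalIntegral.integral_of_le hle (f := fun x : ℝ => ∫ y : ℝ in -R..R, _)] at h1
    simp only [intervalIntegral.integral_of_le hle (f := fun y : ℝ => _ - fderiv ℝ F _ _)] at h1
    rw [hφ]
    simp only [smul_eq_mul]
    rw [← h1]
    have a1 : IntervalIntegrable (fun t : ℝ => F (t - R * Complex.I)) volume (-R) R :=
      (hFc.comp (by fun_prop)).intervalIntegrable _ _
    have a2 : IntervalIntegrable (fun t : ℝ => F (t + R * Complex.I)) volume (-R) R :=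
      (hFc.comp (by fun_prop)).intervalIntegrable _ _
    have a3 : IntervalIntegrable (fun t : ℝ => F (R + t * Complex.I)) volume (-R) R :=
      (hFc.comp (by fun_prop)).intervalIntegrable _ _
    have a4 : IntervalIntegrable (fun t : ℝ => F (-R + t * Complex.I)) volume (-R) R :=
      (hFc.comp (by fun_prop)).intervalIntegrable _ _
    rw [intervalIntegral.integral_sub ((a1.sub a2).add (a3.const_mul _)) (a4.const_mul _),
      intervalIntegral.integral_add (a1.sub a2) (a3.const_mul _),
      intervalIntegral.integral_sub a1 a2, intervalIntegral.integral_const_mul,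
      intervalIntegral.integral_const_mul]
    simp only [neg_mul, ← sub_eq_add_neg]
  have hT1 : Tendsto (fun R : ℝ => ∫ p in Set.Ioc (-R) R ×ˢ Set.Ioc (-R) R,
      φ (p.1 + p.2 * Complex.I)) atTop (𝓝 (∫ p : ℝ × ℝ, φ (p.1 + p.2 * Complex.I))) := by
    have hmono : Monotone fun R : ℝ => Set.Ioc (-R) R ×ˢ Set.Ioc (-R) R := by
      intro a b hab
      have := Set.Ioc_subset_Ioc (neg_le_neg hab) hab
      exact Set.prod_mono this this
    have hun : ⋃ R : ℝ, Set.Ioc (-R) R ×ˢ Set.Ioc (-R) R = Set.univ := by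
      refine Set.eq_univ_of_forall fun p => Set.mem_iUnion.2 ⟨|p.1| + |p.2| + 1, ?_⟩
      have := neg_abs_le p.1
      have := neg_abs_le p.2
      have := le_abs_self p.1
      have := le_abs_self p.2
      have := abs_nonneg p.1
      have := abs_nonneg p.2
      refine ⟨⟨?_, ?_⟩, ⟨?_, ?_⟩⟩ <;> linarith
    have := tendsto_setIntegral_of_monotone (μ := volume)
      (f := fun p : ℝ × ℝ => φ (p.1 + p.2 * Complex.I))
      (fun R : ℝ => measurableSet_Ioc.prod measurableSet_Ioc) hmono hφ2.integrableOn
    rwa [hun, Measure.restrict_univ] at this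
  -- the boundary term is `-g 0` times the winding number, up to a term that vanishes as `R → ∞`
  have hT2 : Tendsto (fun R : ℝ => ∫ t : ℝ in -R..R, (F (t - R * Complex.I) - F (t + R * Complex.I)
      + Complex.I * F (R + t * Complex.I) - Complex.I * F (-R + t * Complex.I))) atTop
      (𝓝 (-(2 * Real.pi * Complex.I * g 0))) := by
    rw [Metric.tendsto_nhds]
    intro ε hε
    have h1 := (Metric.tendsto_nhds.1 hlim) (ε / 16) (by positivity)
    rw [← Metric.cobounded_eq_cocompact, ← comap_norm_atTop, eventually_comap] at h1
    obtain ⟨N, hN⟩ := eventually_atTop.1 h1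
    filter_upwards [eventually_gt_atTop (max N 0)] with R hR
    have hR0 : 0 < R := (le_max_right _ _).trans_lt hR
    have hRN : N ≤ R := ((le_max_left _ _).trans_lt hR).le
    have hb : ∀ z : ℂ, R ≤ ‖z‖ → z ≠ 0 ∧ ‖z⁻¹ * g z‖ ≤ ε / 16 / R := by
      intro z hz
      have hz0 : z ≠ 0 := norm_pos_iff.1 (hR0.trans_le hz)
      refine ⟨hz0, ?_⟩
      have := hN ‖z‖ (hRN.trans hz) z rfl
      rw [dist_zero_right] at this
      rw [norm_mul, norm_inv, inv_mul_eq_div]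
      gcongr
    have hFz : ∀ z : ℂ, z ≠ 0 → F z = z⁻¹ * g z - z⁻¹ * g 0 := by
      intro z hz
      rw [hF, dslope_of_ne _ hz, slope_def_field, sub_zero, div_eq_inv_mul, mul_sub]
    have hre : ∀ z : ℂ, R ≤ |z.re| → R ≤ ‖z‖ := fun z h => h.trans (Complex.abs_re_le_norm z)
    have him : ∀ z : ℂ, R ≤ |z.im| → R ≤ ‖z‖ := fun z h => h.trans (Complex.abs_im_le_norm z)
    have hpt : ∀ t : ℝ, ‖(F (t - R * Complex.I) - F (t + R * Complex.I)
        + Complex.I * F (R + t * Complex.I) - Complex.I * F (-R + t * Complex.I))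
        - (-g 0) * (4 * Complex.I * (R / (R ^ 2 + t ^ 2) : ℝ))‖ ≤ ε / 4 / R := by
      intro t
      obtain ⟨n1, b1⟩ := hb (t - R * Complex.I) (him _ (by simp [abs_of_pos hR0]))
      obtain ⟨n2, b2⟩ := hb (t + R * Complex.I) (him _ (by simp [abs_of_pos hR0]))
      obtain ⟨n3, b3⟩ := hb (R + t * Complex.I) (hre _ (by simp [abs_of_pos hR0]))
      obtain ⟨n4, b4⟩ := hb (-R + t * Complex.I) (hre _ (by simp [abs_of_pos hR0]))
      have hk : (t - R * Complex.I : ℂ)⁻¹ - (t + R * Complex.I : ℂ)⁻¹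
          + Complex.I * (R + t * Complex.I : ℂ)⁻¹ - Complex.I * (-R + t * Complex.I : ℂ)⁻¹
          = 4 * Complex.I * (R / (R ^ 2 + t ^ 2) : ℝ) := by
        have n5 : (R ^ 2 + t ^ 2 : ℂ) ≠ 0 := by
          have : R ^ 2 + t ^ 2 ≠ 0 := by positivity
          exact_mod_cast this
        have i1 : (t - R * Complex.I : ℂ)⁻¹ = (t + R * Complex.I) / (R ^ 2 + t ^ 2) := by
          rw [inv_eq_one_div, div_eq_div_iff n1 n5]
          linear_combination (R : ℂ) ^ 2 * Complex.I_sq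
        have i2 : (t + R * Complex.I : ℂ)⁻¹ = (t - R * Complex.I) / (R ^ 2 + t ^ 2) := by
          rw [inv_eq_one_div, div_eq_div_iff n2 n5]
          linear_combination (R : ℂ) ^ 2 * Complex.I_sq
        have i3 : (R + t * Complex.I : ℂ)⁻¹ = (R - t * Complex.I) / (R ^ 2 + t ^ 2) := by
          rw [inv_eq_one_div, div_eq_div_iff n3 n5]
          linear_combination (t : ℂ) ^ 2 * Complex.I_sq
        have i4 : (-R + t * Complex.I : ℂ)⁻¹ = (-R - t * Complex.I) / (R ^ 2 + t ^ 2) := by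
          rw [inv_eq_one_div, div_eq_div_iff n4 n5]
          linear_combination (t : ℂ) ^ 2 * Complex.I_sq
        rw [i1, i2, i3, i4]
        push_cast
        field_simp
        ring
      rw [← hk, hFz _ n1, hFz _ n2, hFz _ n3, hFz _ n4]
      set A1 := (t - R * Complex.I : ℂ)⁻¹ * g (t - R * Complex.I)
      set A2 := (t + R * Complex.I : ℂ)⁻¹ * g (t + R * Complex.I)
      set A3 := (R + t * Complex.I : ℂ)⁻¹ * g (R + t * Complex.I)
      set A4 := (-R + t * Complex.I : ℂ)⁻¹ * g (-R + t * Complex.I)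
      have e : ∀ k1 k2 k3 k4 : ℂ, A1 - k1 * g 0 - (A2 - k2 * g 0) + Complex.I * (A3 - k3 * g 0)
          - Complex.I * (A4 - k4 * g 0)
          - (-g 0) * (k1 - k2 + Complex.I * k3 - Complex.I * k4)
          = A1 - A2 + Complex.I * A3 - Complex.I * A4 := by intros; ring
      rw [e]
      have n3' : ‖Complex.I * A3‖ = ‖A3‖ := by simp
      have n4' : ‖Complex.I * A4‖ = ‖A4‖ := by simp
      have t1 := norm_sub_le (A1 - A2 + Complex.I * A3) (Complex.I * A4)
      have t2 := norm_add_le (A1 - A2) (Complex.I * A3)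
      have t3 := norm_sub_le A1 A2
      have t4 : ε / 4 / R = 4 * (ε / 16 / R) := by ring
      rw [t4]
      linarith
    have hint1 : IntervalIntegrable (fun t : ℝ => F (t - R * Complex.I) - F (t + R * Complex.I)
        + Complex.I * F (R + t * Complex.I) - Complex.I * F (-R + t * Complex.I)) volume (-R) R := by
      refine Continuous.intervalIntegrable ?_ _ _
      fun_prop
    have hint2 : IntervalIntegrable
        (fun t : ℝ => (-g 0) * (4 * Complex.I * (R / (R ^ 2 + t ^ 2) : ℝ))) volume (-R) R := by
      refine Continuous.intervalIntegrable ?_ _ _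
      have : Continuous fun t : ℝ => R / (R ^ 2 + t ^ 2) :=
        continuous_const.div (by fun_prop) fun t => by positivity
      fun_prop
    have hdiff := intervalIntegral.integral_sub hint1 hint2
    rw [intervalIntegral.integral_const_mul, integral_boundary_kernel hR0] at hdiff
    have hfin := intervalIntegral.norm_integral_le_of_norm_le_const (a := -R) (b := R)
      fun t _ => hpt t
    rw [hdiff] at hfin
    have hlen : |R - -R| = 2 * R := by rw [sub_neg_eq_add, abs_of_pos (by linarith)]; ring
    have hval : ε / 4 / R * (2 * R) = ε / 2 := by field_simp; ring
    rw [hlen, hval] at hfin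
    rw [dist_eq_norm]
    refine lt_of_le_of_lt (le_of_eq ?_) (hfin.trans_lt (half_lt_self hε))
    congr 2
    ring
  have hT3 := hT2.congr' (by
    filter_upwards [eventually_gt_atTop 0] with R hR using key R hR)
  rw [← integral_congr_ae hφψ]
  exact tendsto_nhds_unique hT1 hT3

end CauchyPompeiu

/-! ### Almost analytic extensions -/

section AlmostAnalytic

theorem bracket_sq (x : ℝ) : bracket x ^ 2 = 1 + x ^ 2 := Real.sq_sqrt (by positivity)

theorem one_le_bracket (x : ℝ) : 1 ≤ bracket x := by
  rw [bracket, Real.one_le_sqrt]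
  nlinarith [sq_nonneg x]

theorem bracket_pos (x : ℝ) : 0 < bracket x := zero_lt_one.trans_le (one_le_bracket x)

theorem abs_le_bracket (x : ℝ) : |x| ≤ bracket x :=
  Real.abs_le_sqrt (by linarith)

theorem continuous_bracket : Continuous bracket := by
  unfold bracket
  fun_prop

theorem integrable_bracket_rpow {γ : ℝ} (hγ : γ < -1) : Integrable fun x => bracket x ^ γ := by
  have h := integrable_rpow_neg_one_add_norm_sq (E := ℝ) (μ := volume) (r := -γ)
    (by simp; linarith)
  refine h.congr (Eventually.of_forall fun x => ?_)
  simp only [bracket, Real.sqrt_eq_rpow, Real.norm_eq_abs, sq_abs]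
  rw [← Real.rpow_mul (by positivity)]
  congr 1
  ring

section Cutoff

variable {τ : ℝ → ℝ → ℝ} (hτ : IsCutoff τ)
include hτ

theorem IsCutoff.exists_nonneg_deriv_bound : ∃ c : ℝ, 0 ≤ c ∧ ∀ x y : ℝ,
    |deriv (fun s : ℝ => τ s y) x| ≤ c / bracket x ∧
      |deriv (fun t : ℝ => τ x t) y| ≤ c / bracket x := by
  obtain ⟨c, hc⟩ := hτ.deriv_bound
  refine ⟨c, ?_, hc⟩
  have := (abs_nonneg _).trans (hc 0 0).1
  by_contra h
  exact absurd this (not_le.2 (div_neg_of_neg_of_pos (not_le.1 h) (bracket_pos 0)))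

theorem IsCutoff.differentiable_left (y : ℝ) : Differentiable ℝ fun s => τ s y :=
  (hτ.smooth.differentiable (by simp)).comp (by fun_prop : Differentiable ℝ fun s : ℝ => (s, y))

theorem IsCutoff.differentiable_right (x : ℝ) : Differentiable ℝ fun t => τ x t :=
  (hτ.smooth.differentiable (by simp)).comp (by fun_prop : Differentiable ℝ fun t : ℝ => (x, t))

/-- The cut-off itself is bounded: it is `1` for `y = 0`, and `|∂τ/∂y| ≤ c / ⟨x⟩` on an interval
of length `O(⟨x⟩)`. -/
theorem IsCutoff.exists_bound : ∃ T : ℝ, 0 ≤ T ∧ ∀ x y : ℝ, |τ x y| ≤ T := by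
  obtain ⟨c, hc0, hc⟩ := hτ.exists_nonneg_deriv_bound
  refine ⟨1 + 2 * c, by linarith, fun x y => ?_⟩
  have hb := bracket_pos x
  by_cases hy : 2 * bracket x ≤ |y|
  · rw [hτ.eq_zero x y hy, abs_zero]
    linarith
  · have h1 := Convex.norm_image_sub_le_of_norm_deriv_le (f := fun t => τ x t)
      (fun t _ => (hτ.differentiable_right x) t) (fun t _ => (hc x t).2) convex_univ
      (Set.mem_univ 0) (Set.mem_univ y)
    rw [hτ.eq_one x 0 (by simpa using hb.le), Real.norm_eq_abs, Real.norm_eq_abs, sub_zero] at h1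
    have h2 : c / bracket x * |y| ≤ 2 * c := by
      rw [div_mul_eq_mul_div, div_le_iff₀ hb]
      nlinarith
    have h3 := abs_sub_abs_le_abs_sub (τ x y) 1
    rw [abs_one] at h3
    linarith

theorem IsCutoff.deriv_eq_zero_of_lt {x y : ℝ} (h : 2 * bracket x < |y|) :
    deriv (fun s : ℝ => τ s y) x = 0 ∧ deriv (fun t : ℝ => τ x t) y = 0 := by
  constructor
  · have : (fun s => τ s y) =ᶠ[𝓝 x] fun _ => 0 := by
      have h1 : ∀ᶠ s in 𝓝 x, 2 * bracket s < |y| :=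
        (continuous_const.mul continuous_bracket).continuousAt.eventually_lt continuousAt_const h
      filter_upwards [h1] with s hs using hτ.eq_zero s y hs.le
    rw [this.deriv_eq, deriv_const]
  · have : (fun t => τ x t) =ᶠ[𝓝 y] fun _ => 0 := by
      have h1 : ∀ᶠ t in 𝓝 y, 2 * bracket x < |t| :=
        continuousAt_const.eventually_lt continuous_abs.continuousAt h
      filter_upwards [h1] with t ht using hτ.eq_zero x t ht.le
    rw [this.deriv_eq, deriv_const]

theorem IsCutoff.deriv_eq_zero_of_gt {x y : ℝ} (h : |y| < bracket x) :
    deriv (fun s : ℝ => τ s y) x = 0 ∧ deriv (fun t : ℝ => τ x t) y = 0 := by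
  constructor
  · have : (fun s => τ s y) =ᶠ[𝓝 x] fun _ => 1 := by
      have h1 : ∀ᶠ s in 𝓝 x, |y| < bracket s :=
        continuousAt_const.eventually_lt continuous_bracket.continuousAt h
      filter_upwards [h1] with s hs using hτ.eq_one s y hs.le
    rw [this.deriv_eq, deriv_const]
  · have : (fun t => τ x t) =ᶠ[𝓝 y] fun _ => 1 := by
      have h1 : ∀ᶠ t in 𝓝 y, |t| < bracket x :=
        continuous_abs.continuousAt.eventually_lt continuousAt_const h
      filter_upwards [h1] with t ht using hτ.eq_one x t ht.le
    rw [this.deriv_eq, deriv_const]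

/-- As the derivatives of the cut-off live where `⟨x⟩ ≤ |y|`, their decay can be traded for a factor
`|y|`, which compensates the growth of the resolvent at the real axis. -/
theorem IsCutoff.exists_deriv_bound_abs : ∃ c : ℝ, 0 ≤ c ∧ ∀ x y : ℝ,
    |deriv (fun s : ℝ => τ s y) x| ≤ c * |y| / bracket x ^ 2 ∧
      |deriv (fun t : ℝ => τ x t) y| ≤ c * |y| / bracket x ^ 2 := by
  obtain ⟨c, hc0, hc⟩ := hτ.exists_nonneg_deriv_bound
  refine ⟨c, hc0, fun x y => ?_⟩
  have hb := bracket_pos x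
  rcases lt_or_ge |y| (bracket x) with h | h
  · obtain ⟨h1, h2⟩ := hτ.deriv_eq_zero_of_gt h
    rw [h1, h2, abs_zero]
    exact ⟨by positivity, by positivity⟩
  · have h1 : c / bracket x ≤ c * |y| / bracket x ^ 2 := by
      rw [div_le_div_iff₀ hb (by positivity)]
      have : c * bracket x * bracket x ≤ c * bracket x * |y| := by gcongr
      nlinarith
    exact ⟨(hc x y).1.trans h1, (hc x y).2.trans h1⟩

end Cutoff

/-- The Taylor polynomial `∑ r ≤ n, f⁽ʳ⁾(x) (i y) ^ r / r!` of `f` in the imaginary direction. -/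
def taylorIm (n : ℕ) (f : ℝ → ℂ) (x y : ℝ) : ℂ :=
  ∑ r ∈ Finset.range (n + 1),
    iteratedDeriv r f x * (Complex.I * (y : ℂ)) ^ r / (r.factorial : ℂ)

theorem almostAnalytic_eq (τ : ℝ → ℝ → ℝ) (n : ℕ) (f : ℝ → ℂ) (x y : ℝ) :
    almostAnalytic τ n f x y = taylorIm n f x y * (τ x y : ℂ) := rfl

theorem hasDerivAt_iteratedDeriv {f : ℝ → ℂ} (hf : ContDiff ℝ ∞ f) (r : ℕ) (x : ℝ) :
    HasDerivAt (iteratedDeriv r f) (iteratedDeriv (r + 1) f x) x := by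
  rw [iteratedDeriv_succ]
  exact (hf.differentiable_iteratedDeriv r (by exact_mod_cast ENat.natCast_lt_top r) x).hasDerivAt

theorem hasDerivAt_taylorIm_left {f : ℝ → ℂ} (hf : ContDiff ℝ ∞ f) (n : ℕ) (x y : ℝ) :
    HasDerivAt (fun s => taylorIm n f s y)
      (∑ r ∈ Finset.range (n + 1),
        iteratedDeriv (r + 1) f x * (Complex.I * (y : ℂ)) ^ r / (r.factorial : ℂ)) x :=
  HasDerivAt.fun_sum fun r _ => ((hasDerivAt_iteratedDeriv hf r x).mul_const _).div_const _

theorem hasDerivAt_taylorIm_right (f : ℝ → ℂ) (n : ℕ) (x y : ℝ) :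
    HasDerivAt (fun t => taylorIm n f x t)
      (Complex.I * ∑ r ∈ Finset.range n,
        iteratedDeriv (r + 1) f x * (Complex.I * (y : ℂ)) ^ r / (r.factorial : ℂ)) y := by
  have h1 : HasDerivAt (fun t : ℝ => Complex.I * (t : ℂ)) Complex.I y := by
    simpa using (Complex.ofRealCLM.hasDerivAt (x := y)).const_mul Complex.I
  have h2 := HasDerivAt.fun_sum (u := Finset.range (n + 1)) fun r _ =>
    ((h1.pow r).const_mul (iteratedDeriv r f x)).div_const (r.factorial : ℂ)
  refine h2.congr_deriv ?_
  rw [Finset.sum_range_succ', Finset.mul_sum]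
  simp only [Nat.cast_zero, zero_mul, mul_zero, zero_div, add_zero]
  refine Finset.sum_congr rfl fun r _ => ?_
  have h3 : (r.factorial : ℂ) ≠ 0 := by exact_mod_cast r.factorial_ne_zero
  have h4 : ((r : ℂ) + 1) ≠ 0 := by exact_mod_cast r.succ_ne_zero
  rw [Nat.factorial_succ, Nat.add_sub_cancel]
  push_cast
  field_simp

theorem contDiff_almostAnalytic {τ : ℝ → ℝ → ℝ} (hτ : IsCutoff τ) (n : ℕ) {f : ℝ → ℂ}
    (hf : ContDiff ℝ ∞ f) : ContDiff ℝ ∞ fun p : ℝ × ℝ => almostAnalytic τ n f p.1 p.2 := by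
  have h1 : ContDiff ℝ ∞ fun p : ℝ × ℝ => taylorIm n f p.1 p.2 := by
    refine ContDiff.sum fun r _ => ?_
    have h2 : ContDiff ℝ ∞ (iteratedDeriv r f) := by
      rw [iteratedDeriv_eq_iterate]
      exact ContDiff.iterate_deriv r hf
    have h3 : ContDiff ℝ ∞ fun p : ℝ × ℝ => (p.2 : ℂ) :=
      Complex.ofRealCLM.contDiff.comp contDiff_snd
    exact ((h2.comp contDiff_fst).mul ((contDiff_const.mul h3).pow r)).div_const _
  exact h1.mul (Complex.ofRealCLM.contDiff.comp hτ.smooth)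

/-- The terms of order less than `n` cancel in `∂f̃/∂z̄`: what remains carries a derivative of the
cut-off or the factor `y ^ n`. -/
theorem dbar_almostAnalytic {τ : ℝ → ℝ → ℝ} (hτ : IsCutoff τ) (n : ℕ) {f : ℝ → ℂ}
    (hf : ContDiff ℝ ∞ f) (x y : ℝ) :
    dbar (almostAnalytic τ n f) x y = (1 / 2 : ℂ) *
      (taylorIm n f x y * ((deriv (fun s : ℝ => τ s y) x : ℝ)
          + Complex.I * (deriv (fun t : ℝ => τ x t) y : ℝ))
        + iteratedDeriv (n + 1) f x * (Complex.I * (y : ℂ)) ^ n / (n.factorial : ℂ) * τ x y) := by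
  have h1 := (hasDerivAt_taylorIm_left hf n x y).mul
    ((hτ.differentiable_left y x).hasDerivAt.ofReal_comp)
  have h2 := (hasDerivAt_taylorIm_right f n x y).mul
    ((hτ.differentiable_right x y).hasDerivAt.ofReal_comp)
  have h1' : deriv (fun s : ℝ => almostAnalytic τ n f s y) x = _ := h1.deriv
  have h2' : deriv (fun t : ℝ => almostAnalytic τ n f x t) y = _ := h2.deriv
  rw [dbar, h1', h2', Finset.sum_range_succ]
  linear_combination (1 / 2 : ℂ) * (∑ r ∈ Finset.range n,
        iteratedDeriv (r + 1) f x * (Complex.I * (y : ℂ)) ^ r / (r.factorial : ℂ)) * τ x y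
        * Complex.I_sq

theorem exists_norm_taylorIm_le {β : ℝ} {f : ℝ → ℂ} (hf : f ∈ SymbolClass β) (n : ℕ) :
    ∃ C : ℝ, 0 ≤ C ∧ ∀ x y : ℝ, |y| ≤ 2 * bracket x → ‖taylorIm n f x y‖ ≤ C * bracket x ^ β := by
  choose c hc0 hc using hf.2
  refine ⟨∑ r ∈ Finset.range (n + 1), c r * 2 ^ r,
    Finset.sum_nonneg fun r _ => mul_nonneg (hc0 r).le (by positivity), fun x y hy => ?_⟩
  rw [Finset.sum_mul]
  refine norm_sum_le_of_le _ fun r _ => ?_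
  have hb := bracket_pos x
  rw [norm_div, norm_mul, norm_pow, norm_mul, Complex.norm_I, one_mul, Complex.norm_real,
    Complex.norm_natCast, Real.norm_eq_abs]
  have h1 : (1 : ℝ) ≤ r.factorial := by exact_mod_cast r.factorial_pos
  have h0 := (hc0 r).le
  calc ‖iteratedDeriv r f x‖ * |y| ^ r / r.factorial
      ≤ ‖iteratedDeriv r f x‖ * |y| ^ r := div_le_self (by positivity) h1
    _ ≤ (c r * bracket x ^ (β - r)) * (2 * bracket x) ^ r := by
        gcongr
        exact hc r x
    _ = c r * 2 ^ r * bracket x ^ β := by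
        rw [Real.rpow_sub_natCast hb.ne', mul_pow]
        field_simp

/-- The order `n ≥ 1` of the extension supplies a factor `|y|` in the term with `y ^ n`; the
remaining powers of `|y|` are at most powers of `2⟨x⟩`. -/
theorem exists_norm_dbar_almostAnalytic_le {τ : ℝ → ℝ → ℝ} (hτ : IsCutoff τ) {n : ℕ} (hn : 1 ≤ n)
    {β : ℝ} {f : ℝ → ℂ} (hf : f ∈ SymbolClass β) :
    ∃ C : ℝ, 0 ≤ C ∧ ∀ x y : ℝ,
      ‖dbar (almostAnalytic τ n f) x y‖ ≤ C * |y| * bracket x ^ (β - 2) ∧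
      (2 * bracket x < |y| → dbar (almostAnalytic τ n f) x y = 0) := by
  obtain ⟨C, hC0, hC⟩ := exists_norm_taylorIm_le hf n
  obtain ⟨c, hc0, hc⟩ := hτ.exists_deriv_bound_abs
  obtain ⟨T, hT0, hT⟩ := hτ.exists_bound
  obtain ⟨b, hb0, hb⟩ := hf.2 (n + 1)
  have hzero : ∀ x y : ℝ, 2 * bracket x < |y| → dbar (almostAnalytic τ n f) x y = 0 := by
    intro x y hxy
    obtain ⟨h1, h2⟩ := hτ.deriv_eq_zero_of_lt hxy
    rw [dbar_almostAnalytic hτ n hf.1, h1, h2, hτ.eq_zero x y hxy.le]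
    simp
  refine ⟨C * (c + c) + b * 2 ^ (n - 1) * T, by positivity, fun x y => ⟨?_, hzero x y⟩⟩
  have hx := bracket_pos x
  rcases lt_or_ge (2 * bracket x) |y| with hxy | hxy
  · rw [hzero x y hxy, norm_zero]
    positivity
  have hβ : bracket x ^ (β - 2) = bracket x ^ β / bracket x ^ 2 := by
    rw [← Nat.cast_two, Real.rpow_sub_natCast hx.ne']
  have e1 : ‖taylorIm n f x y * ((deriv (fun s : ℝ => τ s y) x : ℝ)
      + Complex.I * (deriv (fun t : ℝ => τ x t) y : ℝ))‖
      ≤ C * (c + c) * |y| * bracket x ^ (β - 2) := by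
    rw [norm_mul]
    have h1 : ‖((deriv (fun s : ℝ => τ s y) x : ℝ) : ℂ)
        + Complex.I * (deriv (fun t : ℝ => τ x t) y : ℝ)‖
        ≤ c * |y| / bracket x ^ 2 + c * |y| / bracket x ^ 2 := by
      refine (norm_add_le _ _).trans (add_le_add ?_ ?_)
      · rw [Complex.norm_real]
        exact (hc x y).1
      · rw [norm_mul, Complex.norm_I, one_mul, Complex.norm_real]
        exact (hc x y).2
    calc _ ≤ (C * bracket x ^ β) * (c * |y| / bracket x ^ 2 + c * |y| / bracket x ^ 2) :=
          mul_le_mul (hC x y hxy) h1 (norm_nonneg _) (by positivity)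
      _ = _ := by rw [hβ]; ring
  have e2 : ‖iteratedDeriv (n + 1) f x * (Complex.I * (y : ℂ)) ^ n / (n.factorial : ℂ) * τ x y‖
      ≤ b * 2 ^ (n - 1) * T * |y| * bracket x ^ (β - 2) := by
    have h1 : (1 : ℝ) ≤ n.factorial := by exact_mod_cast n.factorial_pos
    rw [norm_mul, norm_div, norm_mul, norm_pow, norm_mul, Complex.norm_I, one_mul,
      Complex.norm_real, Complex.norm_real, Complex.norm_natCast, Real.norm_eq_abs,
      Real.norm_eq_abs]
    obtain ⟨m, rfl⟩ := Nat.exists_eq_add_of_le' hn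
    rw [Nat.add_sub_cancel]
    calc _ ≤ ‖iteratedDeriv (m + 1 + 1) f x‖ * |y| ^ (m + 1) * T := by
          gcongr
          · exact div_le_self (by positivity) h1
          · exact hT x y
      _ = ‖iteratedDeriv (m + 1 + 1) f x‖ * (|y| ^ m * |y|) * T := by rw [pow_succ]
      _ ≤ (b * bracket x ^ (β - (m + 1 + 1 : ℕ))) * ((2 * bracket x) ^ m * |y|) * T := by
          gcongr
          exact hb x
      _ = _ := by
          rw [Real.rpow_sub_natCast hx.ne', hβ, mul_pow]
          field_simp
          ring
  rw [dbar_almostAnalytic hτ n hf.1, norm_mul]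
  have h2 : ‖(1 / 2 : ℂ)‖ ≤ 1 := by norm_num
  refine (mul_le_of_le_one_left (norm_nonneg _) h2).trans ((norm_add_le _ _).trans ?_)
  linarith

/-- The decay of `∂f̃/∂z̄` away from the real axis and at infinity, in a form that makes the
Helffer–Sjöstrand integral absolutely convergent. -/
theorem exists_integrable_dbar_bound {τ : ℝ → ℝ → ℝ} (hτ : IsCutoff τ) {n : ℕ} (hn : 1 ≤ n)
    {f : ℝ → ℂ} (hf : f ∈ SlowDecay) :
    ∃ g : ℝ × ℝ → ℝ, Integrable g ∧
      ∀ p : ℝ × ℝ, ‖dbar (almostAnalytic τ n f) p.1 p.2‖ ≤ |p.2| * g p := by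
  simp only [SlowDecay, Set.mem_iUnion] at hf
  obtain ⟨β, hβ, hf⟩ := hf
  obtain ⟨C, hC0, hC⟩ := exists_norm_dbar_almostAnalytic_le hτ hn hf
  have hγ : β / 2 - 1 < -1 := by linarith
  set γ := β / 2 - 1 with hγdef
  refine ⟨fun p => C * 3 ^ (-γ) * (bracket p.1 ^ γ * bracket p.2 ^ γ),
    ((integrable_bracket_rpow hγ).mul_prod (integrable_bracket_rpow hγ)).const_mul _, ?_⟩
  rintro ⟨x, y⟩
  have hx := bracket_pos x
  have hy := bracket_pos y
  rcases lt_or_ge (2 * bracket x) |y| with hxy | hxy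
  · simp only [(hC x y).2 hxy, norm_zero]
    positivity
  · have h1 : bracket y ≤ 3 * bracket x := by
      refine le_of_sq_le_sq ?_ (by positivity)
      rw [mul_pow, bracket_sq]
      have h2 : y ^ 2 ≤ (2 * bracket x) ^ 2 := by
        rw [← sq_abs y]
        gcongr
      nlinarith [one_le_bracket x]
    have h2 : bracket x ^ γ ≤ 3 ^ (-γ) * bracket y ^ γ := by
      have h3 : bracket x ^ γ ≤ (bracket y / 3) ^ γ :=
        Real.rpow_le_rpow_of_nonpos (by positivity) (by linarith) (by linarith)
      refine h3.trans (le_of_eq ?_)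
      rw [Real.div_rpow hy.le (by norm_num), Real.rpow_neg (by norm_num)]
      ring
    calc _ ≤ C * |y| * bracket x ^ (β - 2) := (hC x y).1
      _ = C * |y| * (bracket x ^ γ * bracket x ^ γ) := by
          rw [← Real.rpow_add hx, hγdef]
          congr 2
          ring
      _ ≤ C * |y| * (bracket x ^ γ * (3 ^ (-γ) * bracket y ^ γ)) := by gcongr
      _ = _ := by ring

theorem dbar_eq_fderiv {G : ℝ → ℝ → ℂ} (hG : Differentiable ℝ fun p : ℝ × ℝ => G p.1 p.2)
    (p : ℝ × ℝ) : dbar G p.1 p.2 = (1 / 2 : ℂ) *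
      (fderiv ℝ (fun p : ℝ × ℝ => G p.1 p.2) p (1, 0)
        + Complex.I * fderiv ℝ (fun p : ℝ × ℝ => G p.1 p.2) p (0, 1)) := by
  have e1 : HasDerivAt (fun s : ℝ => (s, p.2)) ((1 : ℝ), (0 : ℝ)) p.1 :=
    (hasDerivAt_id _).prodMk (hasDerivAt_const _ _)
  have e2 : HasDerivAt (fun t : ℝ => (p.1, t)) ((0 : ℝ), (1 : ℝ)) p.2 :=
    (hasDerivAt_const _ _).prodMk (hasDerivAt_id _)
  have e3 := ((hG (p.1, p.2)).hasFDerivAt.comp_hasDerivAt p.1 e1).deriv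
  have e4 := ((hG (p.1, p.2)).hasFDerivAt.comp_hasDerivAt p.2 e2).deriv
  simp only [Function.comp_def] at e3 e4
  rw [dbar, e3, e4]

theorem continuous_dbar_almostAnalytic {τ : ℝ → ℝ → ℝ} (hτ : IsCutoff τ) (n : ℕ) {f : ℝ → ℂ}
    (hf : ContDiff ℝ ∞ f) : Continuous fun p : ℝ × ℝ => dbar (almostAnalytic τ n f) p.1 p.2 := by
  have h := contDiff_almostAnalytic hτ n hf
  have h1 : Continuous (fderiv ℝ fun p : ℝ × ℝ => almostAnalytic τ n f p.1 p.2) :=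
    h.continuous_fderiv (by simp)
  rw [funext (dbar_eq_fderiv (h.differentiable (by simp)))]
  fun_prop

/-- On the support of the cut-off `|f̃(x, y)| ≤ C ⟨x⟩ ^ β` and `|(x, y)| ≤ 2⟨x⟩`, so that `f̃` vanishes
at infinity in the plane. -/
theorem tendsto_almostAnalytic {τ : ℝ → ℝ → ℝ} (hτ : IsCutoff τ) (n : ℕ) {f : ℝ → ℂ}
    (hf : f ∈ SlowDecay) :
    Tendsto (fun p : ℝ × ℝ => almostAnalytic τ n f p.1 p.2) (cocompact (ℝ × ℝ)) (𝓝 0) := by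
  simp only [SlowDecay, Set.mem_iUnion] at hf
  obtain ⟨β, hβ, hf⟩ := hf
  obtain ⟨C, hC0, hC⟩ := exists_norm_taylorIm_le hf n
  obtain ⟨T, hT0, hT⟩ := hτ.exists_bound
  have hbound : ∀ᶠ p : ℝ × ℝ in cocompact (ℝ × ℝ),
      ‖almostAnalytic τ n f p.1 p.2‖ ≤ C * T * (‖p‖ / 2) ^ β := by
    have h1 : ∀ᶠ p : ℝ × ℝ in cocompact (ℝ × ℝ), p ≠ 0 :=
      (isCompact_singleton (x := (0 : ℝ × ℝ))).compl_mem_cocompact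
    filter_upwards [h1] with p hp
    have hp0 : 0 < ‖p‖ := norm_pos_iff.2 hp
    rcases lt_or_ge |p.2| (2 * bracket p.1) with h | h
    · have h2 : ‖p‖ / 2 ≤ bracket p.1 := by
        have : ‖p‖ ≤ 2 * bracket p.1 := by
          refine max_le ?_ h.le
          have := abs_le_bracket p.1
          have := bracket_pos p.1
          rw [Real.norm_eq_abs]
          linarith
        linarith
      rw [almostAnalytic_eq, norm_mul, Complex.norm_real, Real.norm_eq_abs]
      have hx := bracket_pos p.1
      calc _ ≤ (C * bracket p.1 ^ β) * T :=
            mul_le_mul (hC _ _ h.le) (hT _ _) (abs_nonneg _) (by positivity)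
        _ ≤ (C * (‖p‖ / 2) ^ β) * T := by
            have := Real.rpow_le_rpow_of_nonpos (by positivity) h2 hβ.le
            gcongr
        _ = _ := by ring
    · rw [almostAnalytic_eq, hτ.eq_zero _ _ h, Complex.ofReal_zero, mul_zero, norm_zero]
      positivity
  refine squeeze_zero_norm' hbound ?_
  have h2 : Tendsto (fun t : ℝ => t ^ β) atTop (𝓝 0) := by
    simpa using tendsto_rpow_neg_atTop (y := -β) (by linarith)
  have h3 := (h2.comp ((tendsto_norm_cocompact_atTop (E := ℝ × ℝ)).atTop_div_const
    (two_pos : (0 : ℝ) < 2))).const_mul (C * T)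
  simpa using h3

end AlmostAnalytic

/-! ### Elements of `𝒜` as superpositions of Cauchy kernels -/

section Representation

/-- The Cauchy–Pompeiu formula in real coordinates, at a point of the real axis. -/
theorem integral_dbar_mul_inv_sub {G : ℝ → ℝ → ℂ}
    (hG : Differentiable ℝ fun p : ℝ × ℝ => G p.1 p.2) (s : ℝ) (h0 : dbar G s 0 = 0)
    (hlim : Tendsto (fun p : ℝ × ℝ => G p.1 p.2) (cocompact (ℝ × ℝ)) (𝓝 0))
    (hint : Integrable fun p : ℝ × ℝ =>
      dbar G p.1 p.2 * ((p.1 : ℂ) + (p.2 : ℂ) * Complex.I - s)⁻¹) :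
    ∫ p : ℝ × ℝ, dbar G p.1 p.2 * ((p.1 : ℂ) + (p.2 : ℂ) * Complex.I - s)⁻¹
      = -(Real.pi * G s 0) := by
  set g : ℂ → ℂ := fun z => G (z.re + s) z.im with hgdef
  have hA : ∀ z, HasFDerivAt (fun z : ℂ => Complex.equivRealProdCLM z + (s, 0))
      (Complex.equivRealProdCLM : ℂ →L[ℝ] ℝ × ℝ) z := fun z =>
    Complex.equivRealProdCLM.hasFDerivAt.add_const _
  have hgA : g = fun z => (fun p : ℝ × ℝ => G p.1 p.2) (Complex.equivRealProdCLM z + (s, 0)) := by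
    funext z
    simp [hgdef]
  have hgd : ∀ z, HasFDerivAt g _ z := fun z => by
    rw [hgA]
    exact (hG _).hasFDerivAt.comp z (hA z)
  have hdiff : Differentiable ℝ g := fun z => (hgd z).differentiableAt
  have hdbar : ∀ z : ℂ, Complex.I * fderiv ℝ g z 1 - fderiv ℝ g z Complex.I
      = 2 * Complex.I * dbar G (z.re + s) z.im := by
    intro z
    have h1 := dbar_eq_fderiv hG (Complex.equivRealProdCLM z + (s, 0))
    have h2 : Complex.equivRealProdCLM z + (s, 0) = (z.re + s, z.im) := by simp
    rw [(hgd z).fderiv]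
    simp only [h2] at h1 ⊢
    rw [h1]
    simp
    linear_combination (-(fderiv ℝ (fun p : ℝ × ℝ => G p.1 p.2) (z.re + s, z.im) (0, 1)))
      * Complex.I_sq
  have hC : DifferentiableAt ℂ g 0 := by
    rw [differentiableAt_complex_iff_differentiableAt_real]
    refine ⟨hdiff 0, ?_⟩
    have h1 := hdbar 0
    simp only [Complex.zero_re, Complex.zero_im, zero_add, h0, mul_zero] at h1
    exact (sub_eq_zero.1 h1).symm
  have hglim : Tendsto g (cocompact ℂ) (𝓝 0) := by
    rw [hgA]
    exact hlim.comp ((Complex.equivRealProdCLM.toHomeomorph.trans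
      (Homeomorph.addRight ((s, 0) : ℝ × ℝ))).isClosedEmbedding.tendsto_cocompact)
  have hcongr : (fun p : ℝ × ℝ => (Complex.I * fderiv ℝ g (p.1 + p.2 * Complex.I) 1
        - fderiv ℝ g (p.1 + p.2 * Complex.I) Complex.I) * (p.1 + p.2 * Complex.I : ℂ)⁻¹)
      = fun p : ℝ × ℝ => 2 * Complex.I * (fun q : ℝ × ℝ =>
        dbar G q.1 q.2 * ((q.1 : ℂ) + (q.2 : ℂ) * Complex.I - s)⁻¹) (p + (s, 0)) := by
    funext p
    rw [hdbar]
    have : ((p.1 + s : ℝ) : ℂ) + (p.2 : ℂ) * Complex.I - s = p.1 + p.2 * Complex.I := by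
      push_cast
      ring
    simp only [Prod.fst_add, Prod.snd_add, add_zero, this]
    simp [mul_assoc]
  have hmain := integral_dbar_mul_inv_zero hdiff hC hglim
    (by rw [hcongr]; exact (hint.comp_add_right _).const_mul _)
  rw [hcongr, integral_const_mul, integral_add_right_eq_self
    (fun q : ℝ × ℝ => dbar G q.1 q.2 * ((q.1 : ℂ) + (q.2 : ℂ) * Complex.I - s)⁻¹)] at hmain
  have h2I : (2 * Complex.I : ℂ) ≠ 0 := by simp
  refine mul_left_cancel₀ h2I (hmain.trans ?_)
  simp only [hgdef, Complex.zero_re, Complex.zero_im, zero_add]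
  ring

theorem contDiff_of_mem_slowDecay {f : ℝ → ℂ} (hf : f ∈ SlowDecay) : ContDiff ℝ ∞ f := by
  obtain ⟨β, -, hf⟩ := Set.mem_iUnion₂.1 hf
  exact hf.1

theorem ae_snd_ne_zero : ∀ᵐ p : ℝ × ℝ, p.2 ≠ 0 :=
  Measure.quasiMeasurePreserving_snd.ae (compl_mem_ae_iff.2 (measure_singleton (0 : ℝ)))

theorem im_ofReal_add_ne_zero {p : ℝ × ℝ} (hp : p.2 ≠ 0) :
    ((p.1 : ℂ) + (p.2 : ℂ) * Complex.I).im ≠ 0 := by simpa using hp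

variable {τ : ℝ → ℝ → ℝ} {n : ℕ}

theorem integrable_dbar_smul_cauchyKernel (hτ : IsCutoff τ) (hn : 1 ≤ n) {f : ℝ → ℂ}
    (hf : f ∈ SlowDecay) :
    Integrable fun p : ℝ × ℝ => dbar (almostAnalytic τ n f) p.1 p.2 •
      cauchyKernel ((p.1 : ℂ) + (p.2 : ℂ) * Complex.I) := by
  obtain ⟨g, hg, hfg⟩ := exists_integrable_dbar_bound hτ hn hf
  have hsm := contDiff_of_mem_slowDecay hf
  have hcont : ContinuousOn (fun p : ℝ × ℝ => cauchyKernel ((p.1 : ℂ) + (p.2 : ℂ) * Complex.I))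
      {p | p.2 ≠ 0} :=
    continuousOn_cauchyKernel.comp (by fun_prop) fun p hp => im_ofReal_add_ne_zero hp
  have hmeas : MeasurableSet {p : ℝ × ℝ | p.2 ≠ 0} :=
    (isOpen_ne.preimage continuous_snd).measurableSet
  have hae := hcont.aestronglyMeasurable (μ := volume) hmeas
  rw [Measure.restrict_eq_self_of_ae_mem (s := {p : ℝ × ℝ | p.2 ≠ 0}) ae_snd_ne_zero] at hae
  refine hg.mono' ((continuous_dbar_almostAnalytic hτ n hsm).aestronglyMeasurable.smul hae) ?_
  filter_upwards [ae_snd_ne_zero] with p hp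
  rw [norm_smul]
  have h1 := norm_cauchyKernel_le ((p.1 : ℂ) + (p.2 : ℂ) * Complex.I)
  have h2 : ((p.1 : ℂ) + (p.2 : ℂ) * Complex.I).im = p.2 := by simp
  rw [h2] at h1
  calc _ ≤ (|p.2| * g p) * |p.2|⁻¹ :=
        mul_le_mul (hfg p) h1 (norm_nonneg _) ((norm_nonneg _).trans (hfg p))
    _ = g p := by
        have := abs_ne_zero.2 hp
        field_simp

/-- Every `f ∈ 𝒜` is the superposition `-(1/π) ∬ (∂f̃/∂z̄) (z - ·)⁻¹ dx dy` of Cauchy kernels, the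
integral being a Bochner integral in `C₀(ℝ)`. -/
theorem integral_dbar_smul_cauchyKernel (hτ : IsCutoff τ) (hn : 1 ≤ n) {f : C₀(ℝ, ℂ)}
    (hf : f ∈ SlowDecayC0) :
    (-(1 / (Real.pi : ℂ))) • ∫ p : ℝ × ℝ, dbar (almostAnalytic τ n f) p.1 p.2 •
      cauchyKernel ((p.1 : ℂ) + (p.2 : ℂ) * Complex.I) = f := by
  have hf' : (f : ℝ → ℂ) ∈ SlowDecay := hf
  have hint := integrable_dbar_smul_cauchyKernel hτ hn hf'
  have hsm := contDiff_of_mem_slowDecay hf'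
  ext s
  have hev : (fun p : ℝ × ℝ => evalC0 s (dbar (almostAnalytic τ n f) p.1 p.2 •
      cauchyKernel ((p.1 : ℂ) + (p.2 : ℂ) * Complex.I))) =ᵐ[volume] fun p : ℝ × ℝ =>
        dbar (almostAnalytic τ n f) p.1 p.2 * ((p.1 : ℂ) + (p.2 : ℂ) * Complex.I - s)⁻¹ := by
    filter_upwards [ae_snd_ne_zero] with p hp
    rw [map_smul, smul_eq_mul, ← cauchyKernel_apply (im_ofReal_add_ne_zero hp)]
    rfl
  have h0 : dbar (almostAnalytic τ n f) s 0 = 0 := by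
    obtain ⟨g, -, hg⟩ := exists_integrable_dbar_bound hτ hn hf'
    have := hg (s, 0)
    rw [abs_zero, zero_mul] at this
    exact norm_le_zero_iff.1 this
  have hval : almostAnalytic τ n f s 0 = f s := by
    rw [almostAnalytic_eq, hτ.eq_one s 0 (by simpa using (bracket_pos s).le), taylorIm,
      Finset.sum_range_succ']
    simp
  have hcp := integral_dbar_mul_inv_sub ((contDiff_almostAnalytic hτ n hsm).differentiable
    (by simp)) s h0 (tendsto_almostAnalytic hτ n hf')
    (((evalC0 s).integrable_comp hint).congr hev)
  rw [← integral_congr_ae hev, (evalC0 s).integral_comp_comm hint, hval] at hcp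
  change (-(1 / (Real.pi : ℂ))) • evalC0 s _ = f s
  rw [hcp, smul_eq_mul]
  have hpi : (Real.pi : ℂ) ≠ 0 := by exact_mod_cast Real.pi_ne_zero
  field_simp

variable {E : Type*} [NormedAddCommGroup E] [InnerProductSpace ℂ E] [CompleteSpace E]
  {H : E →ₗ.[ℂ] E}

theorem resolventCalculus_smul_cauchyKernel_ae (hH : IsSelfAdjoint H) (f : ℝ → ℂ) :
    (fun p : ℝ × ℝ => resolventCalculus hH (dbar (almostAnalytic τ n f) p.1 p.2 •
      cauchyKernel ((p.1 : ℂ) + (p.2 : ℂ) * Complex.I))) =ᵐ[volume] hsIntegrand H τ n f := by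
  filter_upwards [ae_snd_ne_zero] with p hp
  rw [map_smul, resolventCalculus_cauchyKernel hH (im_ofReal_add_ne_zero hp), hsIntegrand]

theorem integrable_hsIntegrand (hH : IsSelfAdjoint H) (hτ : IsCutoff τ) (hn : 1 ≤ n) {f : ℝ → ℂ}
    (hf : f ∈ SlowDecay) : Integrable (hsIntegrand H τ n f) :=
  ((resolventCalculus hH).integrable_comp (integrable_dbar_smul_cauchyKernel hτ hn hf)).congr
    (resolventCalculus_smul_cauchyKernel_ae hH f)

/-- On `𝒜` the Helffer–Sjöstrand formula is the image of the Cauchy kernel representation under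
`resolventCalculus`. -/
theorem hsCalculus_eq_resolventCalculus (hH : IsSelfAdjoint H) (hτ : IsCutoff τ) (hn : 1 ≤ n)
    {f : C₀(ℝ, ℂ)} (hf : f ∈ SlowDecayC0) : hsCalculus H τ n f = resolventCalculus hH f := by
  rw [hsCalculus, ← integral_congr_ae (resolventCalculus_smul_cauchyKernel_ae hH f),
    (resolventCalculus hH).integral_comp_comm (integrable_dbar_smul_cauchyKernel hτ hn hf),
    ← map_smul, integral_dbar_smul_cauchyKernel hτ hn hf]

end Representation

/-! ### Density of `𝒜` in `C₀(ℝ)` -/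

section Density

theorem hasCompactSupport_iteratedDeriv {f : ℝ → ℂ} (hc : HasCompactSupport f) (m : ℕ) :
    HasCompactSupport (iteratedDeriv m f) := by
  induction m with
  | zero => simpa using hc
  | succ m ih =>
    rw [iteratedDeriv_succ]
    exact ih.deriv

theorem mem_symbolClass_of_hasCompactSupport {f : ℝ → ℂ} (hf : ContDiff ℝ ∞ f)
    (hc : HasCompactSupport f) (β : ℝ) : f ∈ SymbolClass β := by
  refine ⟨hf, fun m => ?_⟩
  have hcont : Continuous fun x => (bracket x ^ (-(β - m))) • iteratedDeriv m f x :=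
    (continuous_bracket.rpow_const fun x => Or.inl (bracket_pos x).ne').smul
      (hf.continuous_iteratedDeriv m (by exact_mod_cast (ENat.natCast_lt_top m).le))
  have hcs : HasCompactSupport fun x => (bracket x ^ (-(β - m))) • iteratedDeriv m f x :=
    (hasCompactSupport_iteratedDeriv hc m).mono fun x hx h => hx (by simp [h])
  obtain ⟨C, hC⟩ := hcont.bounded_above_of_compact_support hcs
  refine ⟨|C| + 1, by positivity, fun x => ?_⟩
  have hx := bracket_pos x
  have hpos : 0 < bracket x ^ (β - m) := Real.rpow_pos_of_pos hx _
  have h1 := hC x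
  rw [norm_smul, Real.rpow_neg hx.le, Real.norm_of_nonneg (inv_nonneg.2 hpos.le),
    inv_mul_le_iff₀ hpos, mul_comm] at h1
  exact h1.trans (mul_le_mul_of_nonneg_right (by linarith [le_abs_self C]) hpos.le)

theorem mem_slowDecay_of_hasCompactSupport {f : ℝ → ℂ} (hf : ContDiff ℝ ∞ f)
    (hc : HasCompactSupport f) : f ∈ SlowDecay :=
  Set.mem_iUnion₂.2 ⟨-1, neg_one_lt_zero, mem_symbolClass_of_hasCompactSupport hf hc (-1)⟩

theorem mem_closure_slowDecayC0 (f : C₀(ℝ, ℂ)) : f ∈ closure SlowDecayC0 := by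
  rw [Metric.mem_closure_iff]
  intro ε hε
  obtain ⟨g, hg, hgf, -⟩ := f.continuous.exists_contDiff_approx ⊤
    (ε := fun _ => ε / 4) continuous_const fun _ => by positivity
  have hlim := f.zero_at_infty'
  rw [← Metric.cobounded_eq_cocompact, ← comap_norm_atTop] at hlim
  have h1 := (Metric.tendsto_nhds.1 hlim) (ε / 4) (by positivity)
  rw [eventually_comap] at h1
  obtain ⟨N, hN⟩ := eventually_atTop.1 h1
  let χ : ContDiffBump (0 : ℝ) := ⟨|N| + 1, |N| + 2, by positivity, by linarith⟩
  have hsm : ContDiff ℝ ∞ fun x => χ x • g x := χ.contDiff.smul hg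
  have hcs : HasCompactSupport fun x => χ x • g x := χ.hasCompactSupport.smul_right
  let h : C₀(ℝ, ℂ) := ⟨⟨fun x => χ x • g x, hsm.continuous⟩, hcs.is_zero_at_infty⟩
  refine ⟨h, mem_slowDecay_of_hasCompactSupport hsm hcs, ?_⟩
  rw [dist_eq_norm]
  refine lt_of_le_of_lt (norm_zeroAtInfty_le (C := ε / 2) (by positivity) fun x => ?_)
    (half_lt_self hε)
  change ‖f x - χ x • g x‖ ≤ ε / 2
  -- `f - χ g` splits into the tail `(1 - χ) f` and the smoothing error `χ (f - g)`
  have e1 : ‖f x - g x‖ ≤ ε / 4 := by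
    have := hgf x
    rw [dist_comm, dist_eq_norm] at this
    exact this.le
  have e2 : f x - χ x • g x = (1 - χ x) • f x + χ x • (f x - g x) := by
    module
  have e3 : ‖(1 - χ x) • f x‖ ≤ ε / 4 := by
    rw [norm_smul, Real.norm_of_nonneg (by linarith [χ.le_one (x := x)])]
    rcases le_or_gt N ‖x‖ with hx | hx
    · have := hN ‖x‖ hx x rfl
      rw [dist_zero_right] at this
      exact (mul_le_of_le_one_left (norm_nonneg _) (by linarith [χ.nonneg (x := x)])).trans this.le
    · rw [χ.one_of_mem_closedBall, sub_self, zero_mul]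
      · positivity
      · rw [mem_closedBall_zero_iff]
        change ‖x‖ ≤ |N| + 1
        linarith [le_abs_self N]
  have e4 : ‖χ x • (f x - g x)‖ ≤ ε / 4 := by
    rw [norm_smul, Real.norm_of_nonneg χ.nonneg]
    exact (mul_le_of_le_one_left (norm_nonneg _) χ.le_one).trans e1
  rw [e2]
  exact (norm_add_le _ _).trans (by linarith)

end Density

/-! ### The calculus on `C₀(ℝ)` -/

variable {E : Type*} [NormedAddCommGroup E] [InnerProductSpace ℂ E] [CompleteSpace E]
  {H : E →ₗ.[ℂ] E} {τ : ℝ → ℝ → ℝ} {n : ℕ}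

theorem tendsto_hsCalculus (hH : IsSelfAdjoint H) (hτ : IsCutoff τ) (hn : 1 ≤ n) (f : C₀(ℝ, ℂ)) :
    Tendsto (fun g : C₀(ℝ, ℂ) => hsCalculus H τ n g) (𝓝[SlowDecayC0] f)
      (𝓝 (resolventCalculus hH f)) := by
  refine (((resolventCalculus hH).continuous.tendsto f).mono_left nhdsWithin_le_nhds).congr' ?_
  filter_upwards [self_mem_nhdsWithin] with g hg
  exact (hsCalculus_eq_resolventCalculus hH hτ hn hg).symm

theorem c0Calculus_eq_resolventCalculus (hH : IsSelfAdjoint H) (hτ : IsCutoff τ) (hn : 1 ≤ n)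
    (f : C₀(ℝ, ℂ)) : c0Calculus H τ n f = resolventCalculus hH f :=
  have : (𝓝[SlowDecayC0] f).NeBot := mem_closure_iff_nhdsWithin_neBot.1 (mem_closure_slowDecayC0 f)
  (tendsto_hsCalculus hH hτ hn f).limUnder_eq

end HelfferSjostrand
end
open HelfferSjostrand in
theorem mainTheorem4 {E : Type*} [NormedAddCommGroup E] [InnerProductSpace ℂ E] [CompleteSpace E]
    (H : E →ₗ.[ℂ] E) (hH : IsSelfAdjoint H)
    (τ : ℝ → ℝ → ℝ) (hτ : IsCutoff τ) (n : ℕ) (hn : 1 ≤ n) (f : C₀(ℝ, ℂ)) :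
    (∀ g ∈ SlowDecay, Integrable (hsIntegrand H τ n g)) ∧
    f ∈ closure SlowDecayC0 ∧
    Tendsto (fun g : C₀(ℝ, ℂ) => hsCalculus H τ n g) (𝓝[SlowDecayC0] f) (𝓝 (c0Calculus H τ n f)) ∧
    closure (f '' {s : ℝ | (s : ℂ) ∈ opSpectrum H}) ⊆ spectrum ℂ (c0Calculus H τ n f) := by
  rw [c0Calculus_eq_resolventCalculus hH hτ hn f]
  exact ⟨fun g hg => integrable_hsIntegrand hH hτ hn hg, mem_closure_slowDecayC0 f,
    tendsto_hsCalculus hH hτ hn f,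
    closure_minimal (image_subset_spectrum_resolventCalculus hH f) (spectrum.isClosed _)⟩
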